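/- Let $G=(V,E)$ be the complete graph on a finite vertex set $V$, let $s\ne t$ be two vertices, and let $c\in\mathbb{R}_{\ge 0}^E$ be metric edge costs, i.e. nonnegative and satisfying the triangle inequality. For $S\subseteq V$ let $\delta(S)$ be the set of edges with exactly one end in $S$, write $\delta(v)=\delta(\{v\})$, and for $x\in\mathbb{R}^E$ put $x(D)=\sum_{e\in D}x_e$ and $c(x)=\sum_{e\in E}c_ex_e$. Let $x\in\mathbb{R}^E$ be a half-integral ($2x\in\mathbb{Z}^E$) feasible solution of the path version of the Held–Karp relaxation (L.P.1): $$x(\delta(s))=x(\delta(t))=1,\qquad x(\delta(v))=2\ \ (v\ne s,t),$$ $$x(\delta(S))\ge 1\ \text{ if } |S\cap\{s,t\}|=1,\qquad x(\delta(S))\ge 2\ \text{ if } |S\cap\{s,t\}| \text{ is even}\qquad(\emptyset\subsetneq S\subsetneq V),\qquad 0\le x_e\le 1 .$$ The randomized Christofides' algorithm on input $x$ does the following. It writes $x=\sum_{i=1}^{l}\lambda_i\mathcal{X}^{J_i}$ as a convex combination ($\lambda_i>0$, $\sum_i\lambda_i=1$) of edge incidence vectors of spanning trees $J_i$ of $G$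 and samples $J=J_i$ with probability $\lambda_i$. Let $T$ be the set of wrong degree vertices of $J$, i.e. those $v\in\{s,t\}$ with $|\delta(v)\cap J|$ even and those $v\in V\setminus\{s,t\}$ with $|\delta(v)\cap J|$ odd. It adds to $J$ a minimum-cost $T$-join $F$ (an edge set whose odd-degree vertices are exactly those of $T$; $T=\emptyset$ is allowed), keeping duplicated edges, takes an Eulerian traversal from $s$ to $t$ of the resulting multigraph $J\,\dot\cup\,F$, and shortcuts it to an $s$-$t$ path through the same vertices, which it outputs. Then every step of the algorithm can be carried out, whatever choices were made in the earlier steps; for every $i$, the vector $\tfrac12x$ is feasible for the $T$-join polyhedron $\{y\in\mathbb{R}_{\ge0}^E: y(\delta(S))\ge1 \text{ for all } S\subseteq V \text{ with } |S\cap T| \text{ odd}\}$ of the set $T$ of wrong degree vertices of $J_i$ (equivalently, $x(\delta(S))\ge2$ for all such $S$); and, for every possible choice of the decomposition, the $T$-joins, the traversals and the shortcuts, the output is always a Hamiltonian $s$-$t$ path, and its expected cost is at most $\tfrac32c(x)$. -/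

import Mathlib

open Finset

namespace STPathTSP

variable {V : Type*} [Fintype V] [DecidableEq V]

/-- The edge set `E` of the complete graph on `V`. Vectors indexed by `E` are written as functions
on `Sym2 V`; their values on the diagonal are never used. -/
def edges (V : Type*) [Fintype V] [DecidableEq V] : Finset (Sym2 V) :=
  (⊤ : SimpleGraph V).edgeFinset

/-- `δ(S)`: the edges with exactly one end in `S`. -/
def cut (S : Finset V) : Finset (Sym2 V) :=
  (edges V).filter fun e => ∃ u ∈ S, ∃ v ∉ S, e = s(u, v)

/-- Metric edge costs on the complete graph: nonnegative, with the triangle inequality.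
(Symmetry is built into `Sym2 V`; distinct vertices may be at cost `0`.) -/
structure IsMetricCost (c : Sym2 V → ℝ) : Prop where
  nonneg : ∀ u v : V, u ≠ v → 0 ≤ c s(u, v)
  triangle : ∀ u v w : V, u ≠ v → v ≠ w → u ≠ w → c s(u, w) ≤ c s(u, v) + c s(v, w)

/-- `c(x)`, the cost of an edge vector. -/
def cost (c x : Sym2 V → ℝ) : ℝ := ∑ e ∈ edges V, c e * x e

/-- Feasibility for the path version of the Held-Karp relaxation (L.P.1). -/
structure IsHeldKarpPath (s t : V) (x : Sym2 V → ℝ) : Prop where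
  deg_s : ∑ e ∈ cut {s}, x e = 1
  deg_t : ∑ e ∈ cut {t}, x e = 1
  deg : ∀ v, v ≠ s → v ≠ t → ∑ e ∈ cut {v}, x e = 2
  cut_st : ∀ S : Finset V, S.Nonempty → S ≠ univ → #(S ∩ {s, t}) = 1 → 1 ≤ ∑ e ∈ cut S, x e
  cut_even : ∀ S : Finset V, S.Nonempty → S ≠ univ → Even #(S ∩ {s, t}) → 2 ≤ ∑ e ∈ cut S, x e
  nonneg : ∀ e ∈ edges V, 0 ≤ x e
  le_one : ∀ e ∈ edges V, x e ≤ 1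

/-- Every coordinate is an integer multiple of `1/2`. -/
def IsHalfIntegral (x : Sym2 V → ℝ) : Prop :=
  ∀ e ∈ edges V, ∃ k : ℤ, x e = (k : ℝ) / 2

/-- `J` is (the edge set of) a spanning tree of the complete graph. -/
def IsSpanningTree (J : Finset (Sym2 V)) : Prop :=
  J ⊆ edges V ∧ (SimpleGraph.fromEdgeSet (J : Set (Sym2 V))).IsTree

/-- The wrong degree vertices of `J`. -/
def wrongDegree (s t : V) (J : Finset (Sym2 V)) : Finset V :=
  univ.filter fun v =>
    ((v = s ∨ v = t) ∧ Even #(cut {v} ∩ J)) ∨ ((v ≠ s ∧ v ≠ t) ∧ Odd #(cut {v} ∩ J))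

/-- `F` is a `T`-join: the set of odd degree vertices of `(V, F)` is `T`. -/
def IsTJoin (T : Finset V) (F : Finset (Sym2 V)) : Prop :=
  F ⊆ edges V ∧ ∀ v, Odd #(cut {v} ∩ F) ↔ v ∈ T

/-- `F` is a minimum-cost `T`-join. -/
def IsMinCostTJoin (c : Sym2 V → ℝ) (T : Finset V) (F : Finset (Sym2 V)) : Prop :=
  IsTJoin T F ∧ ∀ F', IsTJoin T F' → ∑ e ∈ F, c e ≤ ∑ e ∈ F', c e

/-- Feasibility for the `T`-join polyhedron (L.P.3). -/
def IsFractionalTJoin (T : Finset V) (y : Sym2 V → ℝ) : Prop :=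
  (∀ S : Finset V, Odd #(S ∩ T) → 1 ≤ ∑ e ∈ cut S, y e) ∧ ∀ e ∈ edges V, 0 ≤ y e

/-- `W` is an Eulerian traversal of the multigraph `J ∪ F` in which an edge that lies in both `J`
and `F` is kept twice: `W` uses every edge exactly as often as the multigraph contains it. -/
def IsEulerianTraversal {s t : V} (J F : Finset (Sym2 V)) (W : (⊤ : SimpleGraph V).Walk s t) :
    Prop :=
  (W.edges : Multiset (Sym2 V)) = J.val + F.val

/-- `P` is obtained from `W` by shortcutting: a path with the same ends and through the same
vertices, which are met in the order of (one of) their visits by `W`. -/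
def IsShortcut {s t : V} (W P : (⊤ : SimpleGraph V).Walk s t) : Prop :=
  P.IsPath ∧ P.support.Sublist W.support ∧ ∀ v ∈ W.support, v ∈ P.support

/-- The cost of a walk in the complete graph. -/
def walkCost (c : Sym2 V → ℝ) {s t : V} (P : (⊤ : SimpleGraph V).Walk s t) : ℝ :=
  (P.edges.map c).sum

/-- A decomposition of `x` into a convex combination of spanning trees. -/
structure TreeDecomposition (x : Sym2 V → ℝ) where
  /-- the number of trees -/
  l : ℕ
  /-- the trees -/
  J : Fin l → Finset (Sym2 V)
  /-- the coefficients, which are the sampling probabilities -/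
  weight : Fin l → ℝ
  spanningTree : ∀ i, IsSpanningTree (J i)
  weight_pos : ∀ i, 0 < weight i
  weight_sum : ∑ i, weight i = 1
  decomp : ∀ e ∈ edges V, ∑ i, weight i * (if e ∈ J i then 1 else 0) = x e

/-- An implementation of the randomized Christofides' algorithm on input `x`: a convex decomposition
of `x` into spanning trees, from which the algorithm samples the tree `J i` with probability
`weight i`, and for every outcome `i` the choices which the algorithm then makes: a minimum-cost
`T`-join for the set `T` of wrong degree vertices of `J i`, an Eulerian traversal from `s` to `t`,
and a shortcut of it, which is the output. -/
structure RandomizedChristofides (c : Sym2 V → ℝ) (s t : V) (x : Sym2 V → ℝ) extends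
    TreeDecomposition x where
  /-- the `T`-join added to the sampled tree -/
  F : Fin l → Finset (Sym2 V)
  /-- the Eulerian traversal -/
  W : Fin l → (⊤ : SimpleGraph V).Walk s t
  /-- the output for the outcome `i` -/
  output : Fin l → (⊤ : SimpleGraph V).Walk s t
  minCostTJoin : ∀ i, IsMinCostTJoin c (wrongDegree s t (J i)) (F i)
  eulerian : ∀ i, IsEulerianTraversal (J i) (F i) (W i)
  shortcut : ∀ i, IsShortcut (W i) (output i)

/-- The expected cost of the output. -/
def RandomizedChristofides.expectedCost {c : Sym2 V → ℝ} {s t : V} {x : Sym2 V → ℝ}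
    (A : RandomizedChristofides c s t x) : ℝ :=
  ∑ i, A.weight i * walkCost c (A.output i)

end STPathTSP

open scoped symmDiff

namespace STPathTSP

variable {V : Type*} [Fintype V] [DecidableEq V]

/-! ### Cuts and parity -/

/-! Averaged over the decomposition, the tree costs `c(x)`, and shortcutting is free by the triangle
inequality, so it suffices that every minimum `T`-join costs at most `c(x)/2`. By Edmonds and
Johnson (`joinCost_le_of_isFractionalTJoin`) this follows once `x/2` is a fractional `T`-join, i.e.
`x(δ(S)) ≥ 2` whenever `|S ∩ T|` is odd (`IsHeldKarpPath.isFractionalTJoin`). The relaxation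
guarantees this unless `S` separates `s` from `t`. In that case parity makes the sampled tree cross
`S` an even number of times, so at least twice, while every tree crosses at least once; as the
weights are positive, `x(δ(S)) > 1`. Half-integrality makes `x(δ(S))` an integer
(`IsHeldKarpPath.exists_int_cut_eq`), hence at least 2.

Two polyhedral theorems support this. For Edmonds–Johnson, as long as the minimum cost is positive
there is a cut that all minimum `T`-joins cross exactly once (`exists_cut_of_joinCost_pos`);
lowering the costs on it is a dual ascent step, and the process terminates. For Edmonds' tree
decomposition, uncrossing tight sets shows that extreme points of the spanning tree polytope are
integral (`integral_of_mem_extremePoints`), and Krein–Milman finishes. Traversals come from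
Hierholzer's argument (`exists_eulerian_walk`). -/

theorem mk_mem_edges {a b : V} : s(a, b) ∈ edges V ↔ a ≠ b := by
  simp [edges]

theorem mk_mem_cut {S : Finset V} {a b : V} :
    s(a, b) ∈ cut S ↔ (a ∈ S ∧ b ∉ S) ∨ (b ∈ S ∧ a ∉ S) := by
  simp only [cut, mem_filter, mk_mem_edges, Sym2.eq_iff]
  constructor
  · rintro ⟨-, u, hu, v, hv, ⟨rfl, rfl⟩ | ⟨rfl, rfl⟩⟩
    · exact Or.inl ⟨hu, hv⟩
    · exact Or.inr ⟨hu, hv⟩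
  · rintro (⟨ha, hb⟩ | ⟨hb, ha⟩)
    · exact ⟨fun h => hb (h ▸ ha), a, ha, b, hb, Or.inl ⟨rfl, rfl⟩⟩
    · exact ⟨fun h => ha (h ▸ hb), b, hb, a, ha, Or.inr ⟨rfl, rfl⟩⟩

theorem cut_subset_edges (S : Finset V) : cut S ⊆ edges V :=
  filter_subset _ _

theorem cut_univ : cut (univ : Finset V) = ∅ := by
  simp [cut]

theorem mk_mem_cut_singleton {v a b : V} (hab : a ≠ b) : s(a, b) ∈ cut {v} ↔ v = a ∨ v = b := by
  rw [mk_mem_cut]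
  grind

theorem mem_cut_singleton {v : V} {e : Sym2 V} (he : e ∈ edges V) : e ∈ cut {v} ↔ v ∈ e := by
  induction e with
  | _ a b => rw [mk_mem_cut_singleton (mk_mem_edges.1 he), Sym2.mem_iff]

/-- The edges with both ends in `S`. -/
def inside (S : Finset V) : Finset (Sym2 V) :=
  (edges V).filter fun e => ∀ v ∈ e, v ∈ S

theorem mk_mem_inside {S : Finset V} {a b : V} :
    s(a, b) ∈ inside S ↔ a ≠ b ∧ a ∈ S ∧ b ∈ S := by
  simp [inside, mk_mem_edges]

theorem inside_subset_edges (S : Finset V) : inside S ⊆ edges V :=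
  filter_subset _ _

theorem inside_univ : inside (univ : Finset V) = edges V := by
  simp [inside]

/-- The degree sum over `S` counts the edges of the cut once and those inside `S` twice. -/
theorem sum_degree {R : Type*} [CommSemiring R] (x : Sym2 V → R) (S : Finset V) :
    ∑ v ∈ S, ∑ e ∈ cut {v}, x e = ∑ e ∈ cut S, x e + 2 * ∑ e ∈ inside S, x e := by
  have key : ∀ D : Finset (Sym2 V), D ⊆ edges V →
      ∑ e ∈ D, x e = ∑ e ∈ edges V, if e ∈ D then x e else 0 := by
    intro D hD
    rw [sum_ite_mem, inter_eq_right.2 hD]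
  rw [sum_congr rfl fun v _ => key _ (cut_subset_edges {v}), key _ (cut_subset_edges S),
    key _ (inside_subset_edges S), sum_comm, mul_sum, ← sum_add_distrib]
  refine sum_congr rfl fun e he => ?_
  induction e with
  | _ a b =>
    have hab := mk_mem_edges.1 he
    simp only [mk_mem_cut_singleton hab, mk_mem_cut, mk_mem_inside]
    have h : ∀ v : V, (if v = a ∨ v = b then x s(a, b) else 0) =
        (if v = a then x s(a, b) else 0) + if v = b then x s(a, b) else 0 := by
      intro v
      by_cases h1 : v = a
      · have : v ≠ b := h1 ▸ hab
        simp [h1, hab]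
      · simp [h1]
    simp only [h, sum_add_distrib, sum_ite_eq']
    by_cases h1 : a ∈ S <;> by_cases h2 : b ∈ S <;> simp [h1, h2, hab, two_mul]

/-- The vertices of odd degree. -/
def oddSet (F : Finset (Sym2 V)) : Finset V :=
  univ.filter fun v => Odd #(cut {v} ∩ F)

theorem mem_oddSet {F : Finset (Sym2 V)} {v : V} : v ∈ oddSet F ↔ Odd #(cut {v} ∩ F) := by
  simp [oddSet]

/-- The handshake lemma modulo 2: edges inside `S` are counted twice in the degree sum over `S`. -/
theorem odd_card_cut_inter (S : Finset V) (F : Finset (Sym2 V)) :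
    Odd #(cut S ∩ F) ↔ Odd #(S ∩ oddSet F) := by
  have h := sum_degree (fun e => if e ∈ F then 1 else 0 : Sym2 V → ℕ) S
  have h' : ∀ D : Finset (Sym2 V), ∑ e ∈ D, (if e ∈ F then 1 else 0) = #(D ∩ F) := by
    intro D
    rw [sum_boole, filter_mem_eq_inter, Nat.cast_id]
  simp only [h'] at h
  have h2 : S ∩ oddSet F = {v ∈ S | Odd #(cut {v} ∩ F)} := by
    ext v
    simp [oddSet]
  rw [h2, ← odd_sum_iff_odd_card_odd, h, Nat.odd_add]
  simp

theorem even_card_oddSet (F : Finset (Sym2 V)) : Even #(oddSet F) := by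
  have h := odd_card_cut_inter univ F
  rw [cut_univ, univ_inter, empty_inter, card_empty] at h
  exact Nat.not_odd_iff_even.1 fun h' => absurd (h.2 h') (by simp)

theorem isTJoin_iff {T : Finset V} {F : Finset (Sym2 V)} :
    IsTJoin T F ↔ F ⊆ edges V ∧ oddSet F = T := by
  simp [IsTJoin, Finset.ext_iff, mem_oddSet]

theorem IsTJoin.even_card {T : Finset V} {F : Finset (Sym2 V)} (h : IsTJoin T F) : Even #T :=
  (isTJoin_iff.1 h).2 ▸ even_card_oddSet F

theorem IsTJoin.odd_card_cut_inter {T : Finset V} {F : Finset (Sym2 V)} (h : IsTJoin T F)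
    (S : Finset V) : Odd #(cut S ∩ F) ↔ Odd #(S ∩ T) := by
  rw [STPathTSP.odd_card_cut_inter, (isTJoin_iff.1 h).2]

/-! ### Symmetric differences and the existence of `T`-joins. -/

theorem sum_symmDiff_add {α R : Type*} [DecidableEq α] [CommSemiring R] (f : α → R)
    (A B : Finset α) : ∑ e ∈ A ∆ B, f e + 2 * ∑ e ∈ A ∩ B, f e = ∑ e ∈ A, f e + ∑ e ∈ B, f e := by
  have h : A ∆ B = A \ B ∪ B \ A := rfl
  have h1 := sum_inter_add_sum_sdiff A B f
  have h2 := sum_inter_add_sum_sdiff B A f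
  rw [inter_comm] at h2
  rw [h, sum_union (disjoint_left.2 fun x hx hx' => (mem_sdiff.1 hx').2 (mem_sdiff.1 hx).1),
    ← h1, ← h2]
  ring

/-- Moving a part of the symmetric difference from one set to the other one preserves the sum. -/
theorem sum_symmDiff_exchange {α : Type*} [DecidableEq α] (f : α → ℝ) {A B P : Finset α}
    (hP : P ⊆ A ∆ B) : ∑ e ∈ A ∆ P, f e + ∑ e ∈ B ∆ P, f e = ∑ e ∈ A, f e + ∑ e ∈ B, f e := by
  have h1 := sum_symmDiff_add f A P
  have h2 := sum_symmDiff_add f B P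
  have h3 : P = A ∩ P ∪ B ∩ P := by
    ext y
    have := @hP y
    rw [mem_symmDiff] at this
    simp only [mem_union, mem_inter]
    grind
  have h4 : Disjoint (A ∩ P) (B ∩ P) := by
    rw [disjoint_left]
    intro y hy hy'
    have := hP (mem_inter.1 hy).2
    rw [mem_symmDiff] at this
    grind
  have h5 : ∑ e ∈ P, f e = ∑ e ∈ A ∩ P, f e + ∑ e ∈ B ∩ P, f e := by
    rw [← sum_union h4, ← h3]
  linarith

theorem odd_card_symmDiff {α : Type*} [DecidableEq α] (A B : Finset α) :
    Odd #(A ∆ B) ↔ ¬(Odd #A ↔ Odd #B) := by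
  have h := sum_symmDiff_add (fun _ => 1 : α → ℕ) A B
  simp only [sum_const, smul_eq_mul, mul_one] at h
  grind

theorem IsTJoin.symmDiff {T T' : Finset V} {F F' : Finset (Sym2 V)} (h : IsTJoin T F)
    (h' : IsTJoin T' F') : IsTJoin (T ∆ T') (F ∆ F') := by
  refine ⟨fun e he => ?_, fun v => ?_⟩
  · rcases mem_symmDiff.1 he with he | he
    · exact h.1 he.1
    · exact h'.1 he.1
  · have : cut {v} ∩ F ∆ F' = (cut {v} ∩ F) ∆ (cut {v} ∩ F') := inf_symmDiff_distrib_left _ _ _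
    rw [this, odd_card_symmDiff, h.2, h'.2, mem_symmDiff]
    tauto

theorem isTJoin_empty : IsTJoin (∅ : Finset V) ∅ := by
  simp [IsTJoin]

theorem isTJoin_singleton {a b : V} (hab : a ≠ b) : IsTJoin ({a} ∆ {b}) {s(a, b)} := by
  refine ⟨by simpa [mk_mem_edges] using hab, fun v => ?_⟩
  have : Odd #(cut {v} ∩ {s(a, b)}) ↔ s(a, b) ∈ cut {v} := by
    by_cases h : s(a, b) ∈ cut {v}
    · simp [inter_singleton_of_mem h, h]
    · simp [inter_singleton_of_notMem h, h]
  rw [this, mk_mem_cut_singleton hab, mem_symmDiff, mem_singleton, mem_singleton]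
  grind

theorem isTJoin_ne_toggle {T : Finset V} {F : Finset (Sym2 V)} (h : IsTJoin T F) {a b : V}
    (hab : a ≠ b) : IsTJoin (T ∆ ({a} ∆ {b})) (F ∆ {s(a, b)}) :=
  h.symmDiff (isTJoin_singleton hab)

theorem exists_isTJoin {T : Finset V} (hT : Even #T) : ∃ F, IsTJoin T F := by
  obtain ⟨n, hn⟩ : ∃ n, #T = n := ⟨_, rfl⟩
  induction n using Nat.strong_induction_on generalizing T with
  | _ n ih =>
    rcases T.eq_empty_or_nonempty with rfl | ⟨a, ha⟩
    · exact ⟨∅, isTJoin_empty⟩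
    · have h1 : #(T.erase a) = n - 1 := by rw [card_erase_of_mem ha, hn]
      have h0 : 0 < #T := card_pos.2 ⟨a, ha⟩
      have h2 : (T.erase a).Nonempty := by
        rw [← card_pos, h1]
        grind
      obtain ⟨b, hb⟩ := h2
      have h3 : #((T.erase a).erase b) = n - 1 - 1 := by rw [card_erase_of_mem hb, h1]
      obtain ⟨F, hF⟩ := ih (n - 1 - 1) (by omega) (by rw [h3]; grind) h3
      have hab : a ≠ b := (mem_erase.1 hb).1.symm
      have h := isTJoin_ne_toggle hF hab
      have hT' : T = (T.erase a).erase b ∆ ({a} ∆ {b}) := by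
        ext v
        simp only [mem_symmDiff, mem_singleton, mem_erase]
        grind
      rw [← hT'] at h
      exact ⟨_, h⟩

/-! ### Minimum-cost `T`-joins -/

variable {c : Sym2 V → ℝ}

/-- The minimum cost of a `T`-join. -/
noncomputable def joinCost (c : Sym2 V → ℝ) (T : Finset V) : ℝ :=
  sInf ((fun F : Finset (Sym2 V) => ∑ e ∈ F, c e) '' {F | IsTJoin T F})

theorem joinCost_le {T : Finset V} {F : Finset (Sym2 V)} (h : IsTJoin T F) :
    joinCost c T ≤ ∑ e ∈ F, c e :=
  csInf_le ((Set.toFinite _).image _).bddBelow ⟨F, h, rfl⟩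

/-- Evenness of `T` keeps the infimum from being taken over the empty set, where it would default to
0. -/
theorem exists_joinCost_eq (c : Sym2 V → ℝ) {T : Finset V} (hT : Even #T) :
    ∃ F, IsTJoin T F ∧ ∑ e ∈ F, c e = joinCost c T := by
  obtain ⟨F, hF⟩ := exists_isTJoin hT
  exact Set.Nonempty.csInf_mem (Set.Nonempty.image _ ⟨F, hF⟩) ((Set.toFinite _).image _)

theorem exists_isMinCostTJoin (c : Sym2 V → ℝ) {T : Finset V} (hT : Even #T) :
    ∃ F, IsMinCostTJoin c T F := by
  obtain ⟨F, hF, h⟩ := exists_joinCost_eq c hT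
  exact ⟨F, hF, fun F' hF' => h.le.trans (joinCost_le hF')⟩

theorem IsMinCostTJoin.sum_eq {T : Finset V} {F : Finset (Sym2 V)} (h : IsMinCostTJoin c T F) :
    ∑ e ∈ F, c e = joinCost c T := by
  obtain ⟨F', hF', h'⟩ := exists_joinCost_eq c h.1.even_card
  exact le_antisymm (h' ▸ h.2 F' hF') (joinCost_le h.1)

theorem sum_nonneg_of_isTJoin (hc : ∀ e ∈ edges V, 0 ≤ c e) {T : Finset V}
    {F : Finset (Sym2 V)} (h : IsTJoin T F) : 0 ≤ ∑ e ∈ F, c e :=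
  sum_nonneg fun e he => hc e (h.1 he)

theorem sum_symmDiff_le (hc : ∀ e ∈ edges V, 0 ≤ c e) {T : Finset V}
    {F F' : Finset (Sym2 V)} (h : IsTJoin T F) :
    ∑ e ∈ F ∆ F', c e ≤ ∑ e ∈ F, c e + ∑ e ∈ F', c e := by
  have h1 := sum_symmDiff_add c F F'
  have h2 : 0 ≤ ∑ e ∈ F ∩ F', c e := sum_nonneg fun e he => hc e (h.1 (mem_inter.1 he).1)
  linarith

theorem symmDiff_shift₁ {α : Type*} [DecidableEq α] (T A B W : Finset α) :
    T ∆ (A ∆ B) ∆ (A ∆ W) ∆ (B ∆ W) = T := by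
  rw [symmDiff_assoc, symmDiff_assoc, symmDiff_comm A W, symmDiff_comm B W,
    symmDiff_symmDiff_symmDiff_comm W A W B, symmDiff_self, bot_symmDiff, symmDiff_self,
    symmDiff_bot]

theorem symmDiff_shift₂ {α : Type*} [DecidableEq α] (T A B U W X : Finset α) :
    T ∆ (X ∆ A) ∆ (U ∆ W) ∆ (B ∆ A) ∆ (B ∆ U) = T ∆ (X ∆ W) := by
  rw [symmDiff_assoc (T ∆ (X ∆ A) ∆ (U ∆ W)), symmDiff_symmDiff_symmDiff_comm B A B U,
    symmDiff_assoc, symmDiff_assoc]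
  congr 1
  rw [symmDiff_self, bot_symmDiff, symmDiff_assoc, symmDiff_comm (U ∆ W), ← symmDiff_assoc A,
    ← symmDiff_assoc A, symmDiff_self, bot_symmDiff, symmDiff_symmDiff_cancel_left]

theorem even_card_pair_symmDiff {α : Type*} [DecidableEq α] (a b : α) :
    Even #(({a} : Finset α) ∆ {b}) := by
  have := odd_card_symmDiff ({a} : Finset α) {b}
  rw [← Nat.not_odd_iff_even, this]
  simp

theorem even_card_symmDiff {α : Type*} [DecidableEq α] {A B : Finset α} (hA : Even #A) (hB : Even #B) : Even #(A ∆ B) := by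
  rw [← Nat.not_odd_iff_even] at *
  rw [odd_card_symmDiff]
  tauto

/-- If no `T`-join is free, then there is a cut without free edges that all minimum-cost `T`-joins
cross exactly once. -/
theorem exists_cut_of_joinCost_pos (hc : ∀ e ∈ edges V, 0 ≤ c e) {T : Finset V} (hT : Even #T)
    (hpos : 0 < joinCost c T) :
    ∃ S : Finset V, (∀ e ∈ cut S, 0 < c e) ∧
      ∀ F, IsTJoin T F → ∑ e ∈ F, c e = joinCost c T → #(cut S ∩ F) = 1 := by
  obtain ⟨F₀, hF₀, hF₀c⟩ := exists_joinCost_eq c hT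
  obtain ⟨e₀, he₀, he₀c⟩ : ∃ e ∈ F₀, 0 < c e := by
    by_contra! h
    have := sum_nonpos h
    linarith
  obtain ⟨x₀, v₀, rfl⟩ : ∃ a b, e₀ = s(a, b) := by
    induction e₀ with
    | _ a b => exact ⟨a, b, rfl⟩
  have hne₀ : x₀ ≠ v₀ := mk_mem_edges.1 (hF₀.1 he₀)
  have toggle_le : ∀ {T : Finset V} {F : Finset (Sym2 V)} {a b : V}, IsTJoin T F → s(a, b) ∈ F →
      joinCost c (T ∆ ({a} ∆ {b})) ≤ ∑ e ∈ F, c e - c s(a, b) := by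
    intro T F a b hF he
    have h1 := joinCost_le (c := c) (isTJoin_ne_toggle hF (mk_mem_edges.1 (hF.1 he)))
    have h2 := sum_symmDiff_add c F {s(a, b)}
    rw [inter_singleton_of_mem he, sum_singleton] at h2
    linarith
  -- Dropping the positive edge `s(x₀, v₀)` from a minimum `T`-join shows that the minimum over `v`
  -- lies strictly below `joinCost c T`.
  obtain ⟨b, -, hb⟩ := exists_min_image univ (fun v => joinCost c (T ∆ ({x₀} ∆ {v}))) ⟨x₀, mem_univ _⟩
  replace hb := fun v => hb v (mem_univ v)
  have hlt : joinCost c (T ∆ ({x₀} ∆ {b})) < joinCost c T := by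
    have := toggle_le hF₀ he₀
    have := hb v₀
    linarith
  -- The vertices at distance 0 from `b`. Moving the toggled endpoint from `b` to any of them is
  -- free, so all of them attain the same minimum as `b`.
  set S : Finset V := univ.filter fun v => joinCost c ({b} ∆ {v}) = 0 with hS
  have memS : ∀ v, v ∈ S ↔ joinCost c ({b} ∆ {v}) = 0 := by simp [hS]
  have free : ∀ v ∈ S, ∃ Z, IsTJoin ({b} ∆ {v}) Z ∧ ∑ e ∈ Z, c e = 0 := by
    intro v hv
    rw [memS] at hv
    rw [← hv]
    exact exists_joinCost_eq c (even_card_pair_symmDiff _ _)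
  have joinCost_le_of_free : ∀ (T : Finset V) (v : V), Even #T → v ∈ S →
      joinCost c (T ∆ ({b} ∆ {v})) ≤ joinCost c T := by
    intro T v hT hv
    obtain ⟨Z, hZ, hZc⟩ := free v hv
    obtain ⟨F, hF, hFc⟩ := exists_joinCost_eq c hT
    have := joinCost_le (c := c) (hF.symmDiff hZ)
    have := sum_symmDiff_le (F' := Z) hc hF
    linarith
  have pair : ∀ (T : Finset V) (u v w : V), T ∆ ({u} ∆ {v}) ∆ ({v} ∆ {w}) = T ∆ ({u} ∆ {w}) := by
    intro T u v w
    rw [symmDiff_assoc, symmDiff_assoc, symmDiff_symmDiff_cancel_left]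
  have hevT : ∀ v, Even #(T ∆ ({x₀} ∆ {v})) := fun v =>
    even_card_symmDiff hT (even_card_pair_symmDiff _ _)
  have hcut : ∀ v ∈ S, joinCost c (T ∆ ({x₀} ∆ {v})) = joinCost c (T ∆ ({x₀} ∆ {b})) := by
    intro v hv
    refine le_antisymm ?_ (hb v)
    have := joinCost_le_of_free _ v (hevT b) hv
    rwa [pair] at this
  have hSpos : ∀ e ∈ cut S, 0 < c e := by
    have aux : ∀ u ∈ S, ∀ w ∉ S, 0 < c s(u, w) := by
      intro u hu w hw
      have huw : u ≠ w := fun h => hw (h ▸ hu)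
      obtain ⟨Z, hZ, hZc⟩ := free u hu
      refine lt_of_le_of_ne (hc _ (mk_mem_edges.2 huw)) fun h0 => hw ((memS w).2 ?_)
      have h1 := isTJoin_ne_toggle hZ huw
      rw [symmDiff_assoc, symmDiff_symmDiff_cancel_left] at h1
      have h2 := sum_symmDiff_le (F' := {s(u, w)}) hc hZ
      rw [sum_singleton] at h2
      obtain ⟨Z', hZ', hZc'⟩ := exists_joinCost_eq c (even_card_pair_symmDiff b w)
      have := sum_nonneg_of_isTJoin hc hZ'
      have := joinCost_le (c := c) h1
      linarith
    intro e he
    induction e with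
    | _ u w =>
      rcases mk_mem_cut.1 he with h | h
      · exact aux u h.1 w h.2
      · rw [Sym2.eq_swap]
        exact aux w h.1 u h.2
  have hx₀ : x₀ ∉ S := by
    intro h
    have := hcut x₀ h
    rw [symmDiff_self, symmDiff_bot] at this
    linarith
  have hbS : b ∈ S := by
    rw [memS, symmDiff_self]
    obtain ⟨Z, hZ, hZc⟩ := exists_joinCost_eq c (T := (∅ : Finset V)) (by simp)
    have h1 := sum_nonneg_of_isTJoin hc hZ
    have h2 := joinCost_le (c := c) (isTJoin_empty (V := V))
    rw [sum_empty] at h2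
    exact le_antisymm h2 (hZc ▸ h1)
  -- Were a crossing edge `s(u, w)` with `u ∈ S` in `F`, deleting it and adding free joins from `v`
  -- to `b` to `u` would give a join for `T ∆ ({x₀} ∆ {w})` strictly cheaper than the minimum at
  -- `b`.
  have avoid : ∀ v ∈ S, ∀ F, IsTJoin (T ∆ ({x₀} ∆ {v})) F →
      ∑ e ∈ F, c e ≤ joinCost c (T ∆ ({x₀} ∆ {b})) → cut S ∩ F = ∅ := by
    intro v hv F hF hFc
    have aux : ∀ u ∈ S, ∀ w ∉ S, s(u, w) ∉ F := by
      intro u hu w hw he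
      have h1 := toggle_le hF he
      have hev : Even #(T ∆ ({x₀} ∆ {v}) ∆ ({u} ∆ {w})) :=
        even_card_symmDiff (hevT v) (even_card_pair_symmDiff _ _)
      have h2 := joinCost_le_of_free _ v hev hv
      have h3 := joinCost_le_of_free _ u
        (even_card_symmDiff hev (even_card_pair_symmDiff b v)) hu
      have h4 : T ∆ ({x₀} ∆ {v}) ∆ ({u} ∆ {w}) ∆ ({b} ∆ {v}) ∆ ({b} ∆ {u}) =
          T ∆ ({x₀} ∆ {w}) := symmDiff_shift₂ ..
      rw [h4] at h3
      have h5 := hb w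
      have h6 := hSpos s(u, w) (mk_mem_cut.2 (Or.inl ⟨hu, hw⟩))
      linarith
    rw [eq_empty_iff_forall_notMem]
    intro e he
    obtain ⟨he, heF⟩ := mem_inter.1 he
    induction e with
    | _ u w =>
      rcases mk_mem_cut.1 he with h | h
      · exact aux u h.1 w h.2 heF
      · exact aux w h.1 u h.2 (Sym2.eq_swap ▸ heF)
  refine ⟨S, hSpos, fun F hF hFc => ?_⟩
  obtain ⟨F₁, hF₁, hF₁c⟩ := exists_joinCost_eq c (hevT b)
  have hFF : IsTJoin ({x₀} ∆ {b}) (F ∆ F₁) := by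
    have := hF.symmDiff hF₁
    rwa [symmDiff_symmDiff_cancel_left] at this
  classical
  -- `R` collects the vertices reachable from `x₀` within `F ∆ F₁` without crossing `S`, with joins
  -- in place of paths. It contains `x₀` but not `b`, so by parity an edge of `F ∆ F₁` leaves it,
  -- and that edge must enter `S`.
  set R : Finset V := univ.filter fun u => ∃ D ⊆ F ∆ F₁, IsTJoin ({x₀} ∆ {u}) D ∧ cut S ∩ D = ∅
    with hR
  have memR : ∀ u, u ∈ R ↔ ∃ D ⊆ F ∆ F₁, IsTJoin ({x₀} ∆ {u}) D ∧ cut S ∩ D = ∅ := by simp [hR]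
  have hx₀R : x₀ ∈ R := (memR _).2 ⟨∅, by simp, by rw [symmDiff_self]; exact isTJoin_empty, by simp⟩
  have hRS : ∀ u ∈ R, u ∉ S := by
    intro u hu huS
    obtain ⟨D, -, hD, hDS⟩ := (memR u).1 hu
    have h := hD.odd_card_cut_inter S
    have h' : S ∩ ({x₀} ∆ {u}) = {u} := by
      ext y
      simp only [mem_inter, mem_symmDiff, mem_singleton]
      grind
    simp [hDS, h'] at h
  have hodd : Odd #(cut R ∩ (F ∆ F₁)) := by
    rw [hFF.odd_card_cut_inter]
    have h' : R ∩ ({x₀} ∆ {b}) = {x₀} := by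
      ext y
      simp only [mem_inter, mem_symmDiff, mem_singleton]
      grind
    simp [h']
  obtain ⟨e, he⟩ := card_pos.1 hodd.pos
  obtain ⟨u, w, hu, hw, rfl⟩ : ∃ u w, u ∈ R ∧ w ∉ R ∧ e = s(u, w) := by
    have := (mem_inter.1 he).1
    induction e with
    | _ u w =>
      rcases mk_mem_cut.1 this with h | h
      · exact ⟨u, w, h.1, h.2, rfl⟩
      · exact ⟨w, u, h.1, h.2, Sym2.eq_swap⟩
  replace he := (mem_inter.1 he).2
  have huw : u ≠ w := fun h => hw (h ▸ hu)
  obtain ⟨D, hDF, hD, hDS⟩ := (memR u).1 hu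
  have hD' : IsTJoin ({x₀} ∆ {w}) (D ∆ {s(u, w)}) := by
    have := isTJoin_ne_toggle hD huw
    rwa [symmDiff_assoc, symmDiff_symmDiff_cancel_left] at this
  have hDF' : D ∆ {s(u, w)} ⊆ F ∆ F₁ := by
    intro y hy
    rcases mem_symmDiff.1 hy with h | h
    · exact hDF h.1
    · rw [mem_singleton.1 h.1]
      exact he
  have hwS : w ∈ S := by
    by_contra hwS
    refine hw ((memR w).2 ⟨_, hDF', hD', ?_⟩)
    have : cut S ∩ D ∆ {s(u, w)} = (cut S ∩ D) ∆ (cut S ∩ {s(u, w)}) :=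
      inf_symmDiff_distrib_left _ _ _
    rw [this, hDS, inter_singleton_of_notMem, symmDiff_self]
    · rfl
    · rw [mk_mem_cut]
      have := hRS u hu
      tauto
  have hcross : cut S ∩ D ∆ {s(u, w)} = {s(u, w)} := by
    have : cut S ∩ D ∆ {s(u, w)} = (cut S ∩ D) ∆ (cut S ∩ {s(u, w)}) :=
      inf_symmDiff_distrib_left _ _ _
    rw [this, hDS, inter_singleton_of_mem]
    · exact bot_symmDiff _
    · rw [mk_mem_cut]
      exact Or.inr ⟨hwS, hRS u hu⟩
  -- `P` plays the part of a path from `x₀` to its first vertex `w` in `S`. Exchanging it between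
  -- `F` and `F₁` keeps the total cost, and `F₁ ∆ P` costs at least `joinCost c T` because `b` and
  -- `w` are at distance 0. Hence `F ∆ P` is cheap enough to avoid the cut, and `F` crosses it
  -- exactly where `P` does.
  set P := D ∆ {s(u, w)} with hP
  have hsum : ∑ e ∈ F ∆ P, c e + ∑ e ∈ F₁ ∆ P, c e = ∑ e ∈ F, c e + ∑ e ∈ F₁, c e :=
    sum_symmDiff_exchange c hDF'
  have h1 : IsTJoin (T ∆ ({x₀} ∆ {w})) (F ∆ P) := hF.symmDiff hD'
  have h2 : joinCost c T ≤ ∑ e ∈ F₁ ∆ P, c e := by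
    have h := hF₁.symmDiff hD'
    have h3 := joinCost_le (c := c) h
    have hev : Even #(T ∆ ({x₀} ∆ {b}) ∆ ({x₀} ∆ {w})) :=
      even_card_symmDiff (hevT b) (even_card_pair_symmDiff _ _)
    have h4 := joinCost_le_of_free _ w hev hwS
    have h5 : T ∆ ({x₀} ∆ {b}) ∆ ({x₀} ∆ {w}) ∆ ({b} ∆ {w}) = T := symmDiff_shift₁ ..
    rw [h5] at h4
    linarith
  have h3 := avoid w hwS _ h1 (by linarith)
  have h4 : cut S ∩ (F ∆ P) = (cut S ∩ F) ∆ (cut S ∩ P) := inf_symmDiff_distrib_left _ _ _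
  rw [h3, hcross] at h4
  rw [symmDiff_eq_bot.1 h4.symm, card_singleton]

theorem sum_indicator_sub {α : Type*} [DecidableEq α] (c : α → ℝ) (ε : ℝ) (C F : Finset α) :
    ∑ e ∈ F, (c e - if e ∈ C then ε else 0) = ∑ e ∈ F, c e - ε * #(C ∩ F) := by
  rw [sum_sub_distrib, sum_ite_mem, sum_const, nsmul_eq_mul, mul_comm, inter_comm]

/-- Edmonds and Johnson: a fractional `T`-join costs no less than a minimum-cost `T`-join. -/
theorem joinCost_le_of_isFractionalTJoin {T : Finset V} (hT : Even #T) {y : Sym2 V → ℝ}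
    (hy : IsFractionalTJoin T y) (c : Sym2 V → ℝ) (hc : ∀ e ∈ edges V, 0 ≤ c e) :
    joinCost c T ≤ cost c y := by
  classical
  -- The induction measure: positive-cost edges plus `T`-joins that are not minimum.
  obtain ⟨n, hn⟩ : ∃ n, #((edges V).filter fun e => 0 < c e) +
      #(univ.filter fun F => IsTJoin T F ∧ joinCost c T < ∑ e ∈ F, c e) = n := ⟨_, rfl⟩
  induction n using Nat.strong_induction_on generalizing c with
  | _ n ih =>
    rcases le_or_gt (joinCost c T) 0 with h0 | hpos
    · exact h0.trans (sum_nonneg fun e he => mul_nonneg (hc e he) (hy.2 e he))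
    obtain ⟨S, hSpos, hS⟩ := exists_cut_of_joinCost_pos hc hT hpos
    obtain ⟨F₀, hF₀, hF₀c⟩ := exists_joinCost_eq c hT
    have hSF₀ := hS F₀ hF₀ hF₀c
    have hSodd : Odd #(S ∩ T) := by
      rw [← hF₀.odd_card_cut_inter, hSF₀]
      exact odd_one
    obtain ⟨e₀, he₀⟩ := card_pos.1 (hSF₀ ▸ one_pos)
    set bad : Finset (Finset (Sym2 V)) := univ.filter fun F => IsTJoin T F ∧ 1 < #(cut S ∩ F)
    have mem_bad : ∀ F, F ∈ bad ↔ IsTJoin T F ∧ 1 < #(cut S ∩ F) := by simp [bad]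
    -- The thresholds for `ε`: a cut edge becomes free, or a `T`-join crossing the cut `k > 1`
    -- times, which gains `k - 1` times `ε` on the minimum ones, becomes minimum. The least
    -- threshold makes one of the two counts drop.
    set A : Finset ℝ := (cut S).image c ∪
      bad.image fun F => (∑ e ∈ F, c e - joinCost c T) / ((#(cut S ∩ F) : ℝ) - 1) with hA
    have hAne : A.Nonempty :=
      ⟨c e₀, mem_union_left _ (mem_image_of_mem _ (mem_inter.1 he₀).1)⟩
    set ε := A.min' hAne
    have hεmem : ε ∈ A := A.min'_mem hAne
    have hεcut : ∀ e ∈ cut S, ε ≤ c e := fun e he =>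
      A.min'_le _ (mem_union_left _ (mem_image_of_mem _ he))
    have hbadpos : ∀ F ∈ bad, (0 : ℝ) < #(cut S ∩ F) - 1 := by
      intro F hF
      have : (1 : ℝ) < #(cut S ∩ F) := by exact_mod_cast ((mem_bad F).1 hF).2
      linarith
    have hεbad : ∀ F ∈ bad, ε * (#(cut S ∩ F) - 1) ≤ ∑ e ∈ F, c e - joinCost c T := by
      intro F hF
      rw [← le_div_iff₀ (hbadpos F hF)]
      exact A.min'_le _ (mem_union_right _
        (mem_image_of_mem (fun F => (∑ e ∈ F, c e - joinCost c T) / ((#(cut S ∩ F) : ℝ) - 1)) hF))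
    have hbadcost : ∀ F ∈ bad, joinCost c T < ∑ e ∈ F, c e := by
      intro F hF
      obtain ⟨h1, h2⟩ := (mem_bad F).1 hF
      refine lt_of_le_of_ne (joinCost_le h1) fun h => ?_
      rw [hS F h1 h.symm] at h2
      exact lt_irrefl _ h2
    have hεpos : 0 < ε := by
      rcases mem_union.1 hεmem with h | h
      · obtain ⟨e, he, h⟩ := mem_image.1 h
        exact h ▸ hSpos e he
      · obtain ⟨F, hF, h⟩ := mem_image.1 h
        rw [← h]
        exact div_pos (sub_pos.2 (hbadcost F hF)) (hbadpos F hF)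
    set c' : Sym2 V → ℝ := fun e => c e - if e ∈ cut S then ε else 0 with hc'def
    have hle : ∀ e, c' e ≤ c e := by
      intro e
      simp only [hc'def]
      split_ifs <;> linarith
    have hc' : ∀ e ∈ edges V, 0 ≤ c' e := by
      intro e he
      simp only [hc'def]
      split_ifs with h
      · linarith [hεcut e h]
      · linarith [hc e he]
    have hsum' : ∀ F, ∑ e ∈ F, c' e = ∑ e ∈ F, c e - ε * #(cut S ∩ F) :=
      sum_indicator_sub c ε (cut S)
    have hjoin_ge : ∀ F, IsTJoin T F → joinCost c T - ε ≤ ∑ e ∈ F, c' e := by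
      intro F hF
      rw [hsum']
      by_cases h : 1 < #(cut S ∩ F)
      · linarith [hεbad F ((mem_bad F).2 ⟨hF, h⟩)]
      · have h1 := ((hF.odd_card_cut_inter S).2 hSodd).pos
        have h2 : #(cut S ∩ F) = 1 := by omega
        rw [h2]
        push_cast
        linarith [joinCost_le (c := c) hF]
    have hjoin_eq : ∀ F, IsTJoin T F → ∑ e ∈ F, c e = joinCost c T →
        ∑ e ∈ F, c' e = joinCost c T - ε := by
      intro F hF hFc
      rw [hsum', hFc, hS F hF hFc]
      push_cast
      ring
    have hjoin : joinCost c' T = joinCost c T - ε := by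
      refine le_antisymm ((joinCost_le hF₀).trans (hjoin_eq F₀ hF₀ hF₀c).le) ?_
      obtain ⟨F, hF, hFc⟩ := exists_joinCost_eq c' hT
      exact hFc ▸ hjoin_ge F hF
    have hsub1 : ((edges V).filter fun e => 0 < c' e) ⊆ (edges V).filter fun e => 0 < c e :=
      monotone_filter_right _ fun e _ h => h.trans_le (hle e)
    have hsub2 : (univ.filter fun F => IsTJoin T F ∧ joinCost c' T < ∑ e ∈ F, c' e) ⊆
        univ.filter fun F => IsTJoin T F ∧ joinCost c T < ∑ e ∈ F, c e := by
      refine monotone_filter_right _ fun F _ h => ⟨h.1, ?_⟩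
      refine lt_of_le_of_ne (joinCost_le h.1) fun h' => ?_
      have := h.2
      rw [hjoin, hjoin_eq F h.1 h'.symm] at this
      exact lt_irrefl _ this
    have hlt : #((edges V).filter fun e => 0 < c' e) +
        #(univ.filter fun F => IsTJoin T F ∧ joinCost c' T < ∑ e ∈ F, c' e) < n := by
      rw [← hn]
      rcases mem_union.1 hεmem with h | h
      · obtain ⟨e, he, h⟩ := mem_image.1 h
        refine add_lt_add_of_lt_of_le (card_lt_card ?_) (card_le_card hsub2)
        refine (ssubset_iff_of_subset hsub1).2 ⟨e, ?_, ?_⟩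
        · exact mem_filter.2 ⟨cut_subset_edges S he, hSpos e he⟩
        · simp [hc'def, he, h]
      · obtain ⟨F, hF, h⟩ := mem_image.1 h
        refine add_lt_add_of_le_of_lt (card_le_card hsub1) (card_lt_card ?_)
        refine (ssubset_iff_of_subset hsub2).2 ⟨F, ?_, ?_⟩
        · exact mem_filter.2 ⟨mem_univ _, ((mem_bad F).1 hF).1, hbadcost F hF⟩
        · rw [div_eq_iff (hbadpos F hF).ne'] at h
          rw [mem_filter, hjoin, hsum']
          rintro ⟨-, -, h'⟩
          linarith
    have hfin := ih _ hlt c' hc' rfl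
    have hcost : cost c y = cost c' y + ε * ∑ e ∈ cut S, y e := by
      have : ∑ e ∈ cut S, y e = ∑ e ∈ edges V, if e ∈ cut S then y e else 0 := by
        rw [sum_ite_mem, inter_eq_right.2 (cut_subset_edges S)]
      rw [this, cost, cost, mul_sum, ← sum_add_distrib]
      refine sum_congr rfl fun e _ => ?_
      simp only [hc'def]
      split_ifs <;> ring
    -- `y` has value at least 1 on this odd cut, so its cost falls by at least `ε`, exactly the fall
    -- of `joinCost`.
    have := mul_le_mul_of_nonneg_left (hy.1 S hSodd) hεpos.le
    rw [hcost]
    linarith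

/-! ### The spanning tree polytope -/

/-- The spanning tree polytope, with the coordinates on the diagonal set to `0`. -/
def treePolytope (V : Type*) [Fintype V] [DecidableEq V] : Set (Sym2 V → ℝ) :=
  {x | (∀ e ∈ edges V, 0 ≤ x e) ∧ (∀ e ∉ edges V, x e = 0) ∧
    (∀ S : Finset V, S.Nonempty → ∑ e ∈ inside S, x e ≤ #S - 1) ∧
    ∑ e ∈ edges V, x e = Fintype.card V - 1}

theorem inside_inter (A B : Finset V) : inside A ∩ inside B = inside (A ∩ B) := by
  ext e
  simp only [inside, mem_inter, mem_filter]
  grind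

theorem inside_mono {A B : Finset V} (h : A ⊆ B) : inside A ⊆ inside B :=
  monotone_filter_right _ fun _ _ he v hv => h (he v hv)

/-- Uncrossing: the sum over inside edges is supermodular for nonnegative `x`, while the bound `#S -
1` is modular. -/
theorem sum_inside_inter_eq {x : Sym2 V → ℝ} (hx : x ∈ treePolytope V) {A B : Finset V}
    (hA : ∑ e ∈ inside A, x e = #A - 1) (hB : ∑ e ∈ inside B, x e = #B - 1)
    (hAB : (A ∩ B).Nonempty) : ∑ e ∈ inside (A ∩ B), x e = #(A ∩ B) - 1 := by
  obtain ⟨h0, -, hS, -⟩ := hx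
  refine le_antisymm (hS _ hAB) ?_
  have h1 := sum_union_inter (s₁ := inside A) (s₂ := inside B) (f := x)
  have h2 : ∑ e ∈ inside A ∪ inside B, x e ≤ ∑ e ∈ inside (A ∪ B), x e :=
    sum_le_sum_of_subset_of_nonneg
      (union_subset (inside_mono subset_union_left) (inside_mono subset_union_right))
      fun e he _ => h0 e (inside_subset_edges _ he)
  have h3 := hS (A ∪ B) (hAB.mono (inter_subset_left.trans subset_union_left))
  have h4 : (#(A ∪ B) : ℝ) + #(A ∩ B) = #A + #B := by exact_mod_cast card_union_add_card_inter A B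
  rw [inside_inter] at h1
  linarith

theorem le_one_of_mem_treePolytope {x : Sym2 V → ℝ} (hx : x ∈ treePolytope V) {e : Sym2 V}
    (he : e ∈ edges V) : x e ≤ 1 := by
  obtain ⟨h0, -, hS, -⟩ := hx
  induction e with
  | _ a b =>
    have hab := mk_mem_edges.1 he
    have h1 := hS {a, b} (by simp)
    have h2 : inside {a, b} = {s(a, b)} := by
      ext e
      induction e with
      | _ u v =>
        simp only [mk_mem_inside, mem_insert, mem_singleton, Sym2.eq_iff]
        grind
    rw [h2, sum_singleton, card_pair hab] at h1
    norm_num at h1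
    exact h1

/-- Inside a minimal tight set with a fractional edge lie two such edges, and shifting weight
between them in either direction stays feasible. -/
theorem integral_of_mem_extremePoints [Nonempty V] {x : Sym2 V → ℝ}
    (hx : x ∈ (treePolytope V).extremePoints ℝ) : ∀ e ∈ edges V, x e = 0 ∨ x e = 1 := by
  obtain ⟨hxP, hext⟩ := mem_extremePoints.1 hx
  obtain ⟨h0, hd, hle, htot⟩ := hxP
  by_contra! hfrac
  obtain ⟨e₀, he₀, he₀f⟩ := hfrac
  have htight : ∃ S : Finset V, S.Nonempty ∧ ∑ e ∈ inside S, x e = #S - 1 ∧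
      ∃ e ∈ inside S, x e ≠ 0 ∧ x e ≠ 1 :=
    ⟨univ, univ_nonempty, by rw [inside_univ, htot, card_univ], e₀, by rwa [inside_univ], he₀f⟩
  obtain ⟨S, ⟨hSne, hStight, e, heS, hef⟩, hmin⟩ :=
    exists_minimal_of_wellFoundedLT (fun S : Finset V => S.Nonempty ∧
      ∑ e ∈ inside S, x e = #S - 1 ∧ ∃ e ∈ inside S, x e ≠ 0 ∧ x e ≠ 1) htight
  -- By uncrossing and minimality, a tight set that contains one fractional edge of `S` contains all
  -- of `S`.
  have hminS : ∀ g ∈ inside S, x g ≠ 0 ∧ x g ≠ 1 → ∀ B : Finset V,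
      ∑ e ∈ inside B, x e = #B - 1 → g ∈ inside B → S ⊆ B := by
    intro g hgS hg B hB hgB
    have hgI : g ∈ inside (S ∩ B) := by
      rw [← inside_inter]
      exact mem_inter.2 ⟨hgS, hgB⟩
    have hne : (S ∩ B).Nonempty := by
      induction g with
      | _ a b => exact ⟨a, (mk_mem_inside.1 hgI).2.1⟩
    exact (hmin ⟨hne, sum_inside_inter_eq ⟨h0, hd, hle, htot⟩ hStight hB hne, g, hgI, hg⟩
      inter_subset_left).trans inter_subset_right
  -- A single fractional edge is impossible, since the sum over a tight set is an integer.
  obtain ⟨f, hfS, hfe, hff⟩ : ∃ f ∈ inside S, f ≠ e ∧ x f ≠ 0 ∧ x f ≠ 1 := by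
    by_contra! h
    have h1 := add_sum_erase (inside S) x heS
    have h2 : ∃ k : ℤ, ∑ g ∈ (inside S).erase e, x g = k := by
      refine ⟨∑ g ∈ (inside S).erase e, if x g = 0 then 0 else 1, ?_⟩
      push_cast
      refine sum_congr rfl fun g hg => ?_
      have := h g (mem_of_mem_erase hg) (ne_of_mem_erase hg)
      split_ifs with h3
      · exact h3
      · exact this h3
    obtain ⟨k, hk⟩ := h2
    have heE := inside_subset_edges _ heS
    have h3 : 0 < x e := lt_of_le_of_ne (h0 e heE) hef.1.symm
    have h4 : x e < 1 :=
      lt_of_le_of_ne (le_one_of_mem_treePolytope ⟨h0, hd, hle, htot⟩ heE) hef.2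
    have h5 : x e = ((#S - 1 - k : ℤ) : ℝ) := by
      push_cast
      linarith
    rw [h5] at h3 h4
    have h6 : 0 < (#S - 1 - k : ℤ) := by exact_mod_cast h3
    have h7 : (#S - 1 - k : ℤ) < 1 := by exact_mod_cast h4
    omega
  have heE := inside_subset_edges _ heS
  have hfE := inside_subset_edges _ hfS
  set d : Sym2 V → ℝ := fun g => (if g = e then 1 else 0) - if g = f then 1 else 0 with hdef
  have hdsum : ∀ D : Finset (Sym2 V), ∑ g ∈ D, d g =
      (if e ∈ D then 1 else 0) - if f ∈ D then 1 else 0 := by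
    intro D
    rw [sum_sub_distrib, sum_ite_eq', sum_ite_eq']
  -- Slack constraints survive small `ε`; a tight set contains both `e` and `f` or neither, so its
  -- sum does not move.
  have hev : ∀ᶠ ε in nhds (0 : ℝ), x + ε • d ∈ treePolytope V := by
    have hstrict : ∀ a b : ℝ, 0 < a → ∀ᶠ ε in nhds (0 : ℝ), 0 ≤ a + ε * b := by
      intro a b ha
      have : ContinuousAt (fun ε : ℝ => a + ε * b) 0 := by fun_prop
      exact (this.eventually (lt_mem_nhds (by simpa using ha))).mono fun _ h => h.le
    have h1 : ∀ g ∈ edges V, ∀ᶠ ε in nhds (0 : ℝ), 0 ≤ x g + ε * d g := by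
      intro g hg
      by_cases hx0 : x g = 0
      · have hge : g ≠ e := fun h => hef.1 (h ▸ hx0)
        have hgf : g ≠ f := fun h => hff.1 (h ▸ hx0)
        simp [hdef, hge, hgf, hx0]
      · exact hstrict _ _ (lt_of_le_of_ne (h0 g hg) (Ne.symm hx0))
    have h2 : ∀ B : Finset V, B.Nonempty →
        ∀ᶠ ε in nhds (0 : ℝ), 0 ≤ (#B - 1 - ∑ g ∈ inside B, x g) + ε * (-∑ g ∈ inside B, d g) := by
      intro B hB
      by_cases hBt : ∑ g ∈ inside B, x g = #B - 1
      · have : e ∈ inside B ↔ f ∈ inside B :=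
          ⟨fun h => inside_mono (hminS e heS hef B hBt h) hfS,
            fun h => inside_mono (hminS f hfS hff B hBt h) heS⟩
        simp [hdsum, this, hBt]
      · refine hstrict _ _ ?_
        have := lt_of_le_of_ne (hle B hB) hBt
        linarith
    have h1' := (Filter.eventually_all_finset (edges V)).2 h1
    have h2' : ∀ᶠ ε in nhds (0 : ℝ), ∀ B : Finset V, B.Nonempty →
        0 ≤ (#B - 1 - ∑ g ∈ inside B, x g) + ε * (-∑ g ∈ inside B, d g) := by
      refine Filter.eventually_all.2 fun B => ?_
      by_cases hB : B.Nonempty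
      · simpa [hB] using h2 B hB
      · simp [hB]
    filter_upwards [h1', h2'] with ε h3 h4
    refine ⟨h3, fun g hg => ?_, fun B hB => ?_, ?_⟩
    · have hge : g ≠ e := fun h => hg (h ▸ heE)
      have hgf : g ≠ f := fun h => hg (h ▸ hfE)
      simp [hdef, hge, hgf, hd g hg]
    · have := h4 B hB
      simp only [Pi.add_apply, Pi.smul_apply, smul_eq_mul, sum_add_distrib, ← mul_sum]
      linarith
    · simp only [Pi.add_apply, Pi.smul_apply, smul_eq_mul, sum_add_distrib, ← mul_sum, hdsum,
        heE, hfE, if_true, htot]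
      ring
  have hev' : ∀ᶠ ε in nhds (0 : ℝ), x + (-ε) • d ∈ treePolytope V := by
    have : Filter.Tendsto (fun ε : ℝ => -ε) (nhds 0) (nhds 0) := by
      simpa using (continuous_neg (G := ℝ)).tendsto 0
    exact this.eventually hev
  obtain ⟨ε, ⟨h1, h2⟩, hε⟩ := (((hev.and hev').filter_mono nhdsWithin_le_nhds).and
    (self_mem_nhdsWithin : Set.Ioi (0 : ℝ) ∈ nhdsWithin 0 (Set.Ioi 0))).exists
  have h3 := (hext _ h1 _ h2 ⟨1 / 2, 1 / 2, by norm_num, by norm_num, by norm_num, by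
    ext g
    simp only [Pi.add_apply, Pi.smul_apply, smul_eq_mul]
    ring⟩).1
  have h4 := congrFun h3 e
  have h5 : d e = 1 := by simp [hdef, hfe.symm]
  simp only [Pi.add_apply, Pi.smul_apply, smul_eq_mul, h5] at h4
  have : (0 : ℝ) < ε := hε
  linarith

/-! ### From integral points to trees. -/

theorem fromEdgeSet_edgeSet {J : Finset (Sym2 V)} (hJ : J ⊆ edges V) :
    (SimpleGraph.fromEdgeSet (J : Set (Sym2 V))).edgeSet = J := by
  rw [SimpleGraph.edgeSet_fromEdgeSet]
  ext e
  simp only [Set.mem_sdiff, mem_coe]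
  refine ⟨fun h => h.1, fun h => ⟨h, ?_⟩⟩
  have := hJ h
  simpa [edges] using this

/-- If the graph were disconnected, the bounds for a component and for its complement would add up
to at most `Fintype.card V - 2` edges. -/
theorem isSpanningTree_of_card [Nonempty V] {J : Finset (Sym2 V)} (hJ : J ⊆ edges V)
    (hin : ∀ S : Finset V, S.Nonempty → #(J ∩ inside S) + 1 ≤ #S)
    (hcard : #J + 1 = Fintype.card V) : IsSpanningTree J := by
  classical
  refine ⟨hJ, ?_⟩
  rw [SimpleGraph.isTree_iff_connected_and_card]
  refine ⟨⟨fun u v => ?_⟩, ?_⟩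
  · set G := SimpleGraph.fromEdgeSet (J : Set (Sym2 V)) with hG
    set S : Finset V := univ.filter fun w => G.Reachable u w with hS
    have memS : ∀ w, w ∈ S ↔ G.Reachable u w := by simp [hS]
    by_contra hv
    have h1 := hin S ⟨u, (memS u).2 (SimpleGraph.Reachable.refl u)⟩
    have h2 := hin Sᶜ ⟨v, by simpa [memS] using hv⟩
    have h3 : J ⊆ (J ∩ inside S) ∪ (J ∩ inside Sᶜ) := by
      intro e he
      have heE := hJ he
      induction e with
      | _ a b =>
        have hab := mk_mem_edges.1 heE
        have hadj : G.Adj a b := by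
          rw [hG, SimpleGraph.fromEdgeSet_adj]
          exact ⟨he, hab⟩
        have h4 : a ∈ S ↔ b ∈ S := by
          rw [memS, memS]
          exact ⟨fun h => h.trans hadj.reachable, fun h => h.trans hadj.symm.reachable⟩
        simp only [mem_union, mem_inter, mk_mem_inside, mem_compl]
        tauto
    have h4 := (card_le_card h3).trans (card_union_le _ _)
    have h5 := card_add_card_compl S
    omega
  · rw [fromEdgeSet_edgeSet hJ, Nat.card_coe_set_eq, Set.ncard_coe_finset, hcard,
      Nat.card_eq_fintype_card]

theorem extremePoints_subset [Nonempty V] : (treePolytope V).extremePoints ℝ ⊆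
    (fun (J : Finset (Sym2 V)) e => if e ∈ J then (1 : ℝ) else 0) '' {J | IsSpanningTree J} := by
  intro x hx
  have hint := integral_of_mem_extremePoints hx
  obtain ⟨h0, hd, hle, htot⟩ := hx.1
  set J : Finset (Sym2 V) := (edges V).filter fun e => x e = 1 with hJ
  have hxJ : (fun e => if e ∈ J then (1 : ℝ) else 0) = x := by
    ext e
    by_cases he : e ∈ edges V
    · rcases hint e he with h | h <;> simp [hJ, he, h]
    · simp [hJ, he, hd e he]
  have hsum : ∀ D : Finset (Sym2 V), ∑ e ∈ D, x e = #(J ∩ D) := by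
    intro D
    rw [← hxJ, sum_boole, filter_mem_eq_inter, inter_comm]
  refine ⟨J, isSpanningTree_of_card (filter_subset _ _) (fun S hS => ?_) ?_, hxJ⟩
  · have := hle S hS
    rw [hsum] at this
    have h : ((#(J ∩ inside S) + 1 : ℕ) : ℝ) ≤ #S := by
      push_cast
      linarith
    exact_mod_cast h
  · rw [hsum, inter_eq_left.2 (filter_subset _ _)] at htot
    have h : ((#J + 1 : ℕ) : ℝ) = Fintype.card V := by
      push_cast
      linarith
    exact_mod_cast h

theorem convex_treePolytope : Convex ℝ (treePolytope V) := by
  rintro x ⟨h1, h2, h3, h4⟩ y ⟨h1', h2', h3', h4'⟩ a b ha hb hab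
  refine ⟨fun e he => ?_, fun e he => ?_, fun S hS => ?_, ?_⟩
  · exact add_nonneg (mul_nonneg ha (h1 e he)) (mul_nonneg hb (h1' e he))
  · simp [h2 e he, h2' e he]
  · simp only [Pi.add_apply, Pi.smul_apply, smul_eq_mul, sum_add_distrib, ← mul_sum]
    calc a * ∑ e ∈ inside S, x e + b * ∑ e ∈ inside S, y e
        ≤ a * (#S - 1) + b * (#S - 1) := add_le_add (mul_le_mul_of_nonneg_left (h3 S hS) ha)
          (mul_le_mul_of_nonneg_left (h3' S hS) hb)
      _ = #S - 1 := by rw [← add_mul, hab, one_mul]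
  · simp only [Pi.add_apply, Pi.smul_apply, smul_eq_mul, sum_add_distrib, ← mul_sum, h4, h4']
    rw [← add_mul, hab, one_mul]

theorem isCompact_treePolytope : IsCompact (treePolytope V) := by
  refine IsCompact.of_isClosed_subset (isCompact_univ_pi fun _ => isCompact_Icc (a := (0 : ℝ))
    (b := 1)) ?_ ?_
  · have : treePolytope V = (⋂ e ∈ edges V, {x | 0 ≤ x e}) ∩ ((⋂ e ∉ edges V, {x | x e = 0}) ∩
        ((⋂ S : Finset V, ⋂ _ : S.Nonempty, {x | ∑ e ∈ inside S, x e ≤ (#S : ℝ) - 1}) ∩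
          {x | ∑ e ∈ edges V, x e = (Fintype.card V : ℝ) - 1})) := by
      ext x
      simp [treePolytope]
    rw [this]
    refine IsClosed.inter ?_ (IsClosed.inter ?_ (IsClosed.inter ?_ ?_))
    · exact isClosed_biInter fun e _ => isClosed_le (by fun_prop) (by fun_prop)
    · exact isClosed_biInter fun e _ => isClosed_eq (by fun_prop) (by fun_prop)
    · exact isClosed_iInter fun S => isClosed_iInter fun _ =>
        isClosed_le (by fun_prop) (by fun_prop)
    · exact isClosed_eq (by fun_prop) (by fun_prop)
  · intro x hx e _
    by_cases he : e ∈ edges V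
    · exact ⟨hx.1 e he, le_one_of_mem_treePolytope hx he⟩
    · rw [hx.2.1 e he]
      exact ⟨le_rfl, zero_le_one⟩

/-- Edmonds: the points of the spanning tree polytope are convex combinations of trees. -/
theorem nonempty_treeDecomposition [Nonempty V] {x : Sym2 V → ℝ} (hx : x ∈ treePolytope V) :
    Nonempty (TreeDecomposition x) := by
  set X : Set (Sym2 V → ℝ) :=
    (fun (J : Finset (Sym2 V)) e => if e ∈ J then (1 : ℝ) else 0) '' {J | IsSpanningTree J} with hX
  have hmem : x ∈ convexHull ℝ X := by
    have h1 := closure_convexHull_extremePoints (isCompact_treePolytope (V := V))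
      convex_treePolytope
    have h2 : IsClosed (convexHull ℝ X) := ((Set.toFinite _).image _).isClosed_convexHull ℝ
    rw [← h1] at hx
    exact closure_minimal (convexHull_mono extremePoints_subset) h2 hx
  obtain ⟨ι, _, z, w, hz, -, hw, hw1, hsum⟩ := eq_pos_convex_span_of_mem_convexHull hmem
  choose J hJ hJz using fun i => hz ⟨i, rfl⟩
  let φ := (Fintype.equivFin ι).symm
  refine ⟨⟨Fintype.card ι, fun i => J (φ i), fun i => w (φ i), fun i => hJ _, fun i => hw _, ?_,
    fun e _ => ?_⟩⟩
  · rw [φ.sum_comp w, hw1]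
  · rw [φ.sum_comp fun i => w i * if e ∈ J i then 1 else 0, ← hsum, Finset.sum_apply]
    refine sum_congr rfl fun i _ => ?_
    rw [Pi.smul_apply, smul_eq_mul, ← hJz i]

theorem TreeDecomposition.congr {x y : Sym2 V → ℝ} (h : ∀ e ∈ edges V, x e = y e)
    (D : TreeDecomposition x) : Nonempty (TreeDecomposition y) :=
  ⟨{ D with decomp := fun e he => (D.decomp e he).trans (h e he) }⟩

/-! ### Eulerian traversals -/

omit [Fintype V] in
-- Each pass through a vertex uses two edges. The right side says that `x` is exactly one of the two
-- ends, so closed walks, which are also needed, are covered.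
theorem odd_countP_edges {u w : V} (p : (⊤ : SimpleGraph V).Walk u w) (x : V) :
    Odd (p.edges.countP (x ∈ ·)) ↔ ¬(x = u ↔ x = w) := by
  induction p with
  | nil => simp
  | @cons u v w h p ih =>
    rw [SimpleGraph.Walk.edges_cons, List.countP_cons]
    have huv : u ≠ v := h.ne
    by_cases hx : x ∈ s(u, v)
    · simp only [hx, decide_true, if_true, Nat.odd_add_one, ih]
      rw [Sym2.mem_iff] at hx
      grind
    · simp only [hx, decide_false, Bool.false_eq_true, if_false, add_zero, ih]
      rw [Sym2.mem_iff] at hx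
      grind

/-- A maximal trail in the multigraph `M`. -/
theorem exists_maximal_trail {M : Multiset (Sym2 V)} (hM : ∀ e ∈ M, e ∈ edges V) (u : V) :
    ∃ w, ∃ W : (⊤ : SimpleGraph V).Walk u w, (W.edges : Multiset (Sym2 V)) ≤ M ∧
      ∀ e ∈ M - (W.edges : Multiset (Sym2 V)), w ∉ e := by
  induction hn : M.card generalizing M u with
  | zero =>
    rw [Multiset.card_eq_zero] at hn
    exact ⟨u, .nil, by simp [hn]⟩
  | succ n ih =>
    by_cases h : ∃ e ∈ M, u ∈ e
    · obtain ⟨e, he, hu⟩ := h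
      obtain ⟨v, rfl⟩ := Sym2.mem_iff_exists.1 hu
      have huv : u ≠ v := mk_mem_edges.1 (hM _ he)
      obtain ⟨w, W, hW, hw⟩ := ih (M := M.erase s(u, v))
        (fun e he => hM e (Multiset.mem_of_mem_erase he)) v (by
          rw [Multiset.card_erase_of_mem he, hn]
          rfl)
      refine ⟨w, .cons (show (⊤ : SimpleGraph V).Adj u v from huv) W, ?_, ?_⟩
      · rw [SimpleGraph.Walk.edges_cons, ← Multiset.cons_coe, ← Multiset.cons_erase he]
        exact Multiset.cons_le_cons _ hW
      · rw [SimpleGraph.Walk.edges_cons, ← Multiset.cons_coe, Multiset.sub_cons]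
        exact hw
    · push Not at h
      exact ⟨u, .nil, by simp, by simpa using h⟩

omit [Fintype V] in
theorem countP_sub_edges {M : Multiset (Sym2 V)} {u w : V} {W : (⊤ : SimpleGraph V).Walk u w}
    (hW : (W.edges : Multiset (Sym2 V)) ≤ M) (x : V) :
    (M - (W.edges : Multiset (Sym2 V))).countP (x ∈ ·) + W.edges.countP (x ∈ ·) =
      M.countP (x ∈ ·) := by
  conv_rhs => rw [← tsub_add_cancel_of_le hW, Multiset.countP_add, Multiset.coe_countP]

/-- A maximal trail uses up all edges at its last vertex, and parity allows this only at `t`. -/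
theorem exists_trail_of_odd {M : Multiset (Sym2 V)} (hM : ∀ e ∈ M, e ∈ edges V) {s t : V}
    (hodd : ∀ v, Odd (M.countP (v ∈ ·)) ↔ ¬(v = s ↔ v = t)) :
    ∃ W : (⊤ : SimpleGraph V).Walk s t, (W.edges : Multiset (Sym2 V)) ≤ M ∧
      ∀ e ∈ M - (W.edges : Multiset (Sym2 V)), t ∉ e := by
  obtain ⟨w, W, hW, hw⟩ := exists_maximal_trail hM s
  suffices h : w = t by
    subst h
    exact ⟨W, hW, hw⟩
  have h1 := countP_sub_edges hW w
  rw [Multiset.countP_eq_zero.2 hw, zero_add] at h1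
  have h2 := odd_countP_edges W w
  have h3 := hodd w
  rw [← h1, h2] at h3
  by_contra hne
  simp only [hne] at h3
  tauto

/-- Hierholzer: the unused edges have even degrees, and by connectivity one of them meets the walk,
so a closed trail of unused edges can be spliced in there. -/
theorem exists_eulerian_walk {M : Multiset (Sym2 V)} (hM : ∀ e ∈ M, e ∈ edges V) {s t : V}
    (hodd : ∀ v, Odd (M.countP (v ∈ ·)) ↔ ¬(v = s ↔ v = t))
    (hconn : ∀ S : Finset V, S.Nonempty → S ≠ univ → ∃ e ∈ M, e ∈ cut S) :
    ∃ W : (⊤ : SimpleGraph V).Walk s t, (W.edges : Multiset (Sym2 V)) = M := by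
  suffices H : ∀ n, ∀ W : (⊤ : SimpleGraph V).Walk s t, (W.edges : Multiset (Sym2 V)) ≤ M →
      (M - (W.edges : Multiset (Sym2 V))).card = n →
      ∃ W : (⊤ : SimpleGraph V).Walk s t, (W.edges : Multiset (Sym2 V)) = M by
    obtain ⟨W, hW, -⟩ := exists_trail_of_odd hM hodd
    exact H _ W hW rfl
  intro n
  induction n using Nat.strong_induction_on with
  | _ n ih =>
    intro W hW hn
    set R := M - (W.edges : Multiset (Sym2 V)) with hR
    have hMR : M = R + (W.edges : Multiset (Sym2 V)) := (tsub_add_cancel_of_le hW).symm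
    have hRM : ∀ e ∈ R, e ∈ M := fun e he => Multiset.mem_of_le tsub_le_self he
    by_cases hR0 : R = 0
    · exact ⟨W, by rw [hMR, hR0, zero_add]⟩
    obtain ⟨e, he, u, hue, huW⟩ : ∃ e ∈ R, ∃ u ∈ e, u ∈ W.support := by
      obtain ⟨e, he⟩ := Multiset.exists_mem_of_ne_zero hR0
      by_cases hS : W.support.toFinset = univ
      · induction e with
        | _ a b => exact ⟨_, he, a, Sym2.mem_mk_left a b, by simp [← List.mem_toFinset, hS]⟩
      · obtain ⟨f, hf, hfS⟩ := hconn W.support.toFinset ⟨s, by simp⟩ hS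
        have hfW : f ∉ W.edges := by
          intro hfW
          induction f with
          | _ a b =>
            have h1 := W.fst_mem_support_of_mem_edges hfW
            have h2 := W.snd_mem_support_of_mem_edges hfW
            rw [mk_mem_cut] at hfS
            simp [h1, h2] at hfS
        rw [hMR, Multiset.mem_add] at hf
        refine ⟨f, hf.resolve_right (by simpa using hfW), ?_⟩
        induction f with
        | _ a b =>
          rcases mk_mem_cut.1 hfS with h | h
          · exact ⟨a, Sym2.mem_mk_left a b, by simpa using h.1⟩
          · exact ⟨b, Sym2.mem_mk_right a b, by simpa using h.1⟩
    have hReven : ∀ v, Odd (R.countP (v ∈ ·)) ↔ ¬(v = u ↔ v = u) := by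
      intro v
      have h1 := countP_sub_edges hW v
      have h2 := odd_countP_edges W v
      have h3 := hodd v
      rw [← h2, ← h1, Nat.odd_add, ← Nat.not_odd_iff_even] at h3
      simp only [not_true_eq_false, iff_false]
      tauto
    obtain ⟨Z, hZ, hZu⟩ := exists_trail_of_odd (fun e he => hM e (hRM e he)) hReven
    -- The maximal closed trail at `u` is not trivial because the unused edge `e` is available
    -- there; hence the remainder shrinks.
    have hZ0 : 0 < (Z.edges : Multiset (Sym2 V)).card := by
      rw [Multiset.card_pos]
      intro h0
      rw [h0, tsub_zero] at hZu
      exact hZu e he hue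
    set W' := ((W.takeUntil u huW).append Z).append (W.dropUntil u huW) with hW'
    have hW'e : (W'.edges : Multiset (Sym2 V)) = Z.edges + W.edges := by
      have : (W.edges : Multiset (Sym2 V)) =
          (W.takeUntil u huW).edges + (W.dropUntil u huW).edges := by
        rw [Multiset.coe_add, ← SimpleGraph.Walk.edges_append, SimpleGraph.Walk.take_spec]
      rw [this, hW', SimpleGraph.Walk.edges_append, SimpleGraph.Walk.edges_append,
        ← Multiset.coe_add, ← Multiset.coe_add]
      abel
    have hW'M : (W'.edges : Multiset (Sym2 V)) ≤ M := by
      rw [hW'e, hMR]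
      exact add_le_add_left hZ _
    refine ih _ ?_ W' hW'M rfl
    have h1 := congrArg Multiset.card (tsub_add_cancel_of_le hW'M)
    have h2 := congrArg Multiset.card hMR
    have h3 := congrArg Multiset.card hW'e
    rw [Multiset.card_add] at h1 h2 h3
    omega

/-! ### Shortcuts -/

omit [Fintype V] [DecidableEq V] in
/-- Any list of vertices without repetitions is the support of a path in the complete graph. -/
theorem exists_walk_support_eq {s t : V} {l : List V} (hl : (s :: l).Nodup)
    (ht : (s :: l).getLast? = some t) :
    ∃ P : (⊤ : SimpleGraph V).Walk s t, P.support = s :: l := by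
  induction l generalizing s with
  | nil =>
    obtain rfl : s = t := by simpa using ht
    exact ⟨.nil, rfl⟩
  | cons a l ih =>
    obtain ⟨P, hP⟩ := ih (List.nodup_cons.1 hl).2 (by simpa using ht)
    have hsa : s ≠ a := fun h => (List.nodup_cons.1 hl).1 (by simp [h])
    exact ⟨.cons (show (⊤ : SimpleGraph V).Adj s a from hsa) P, by simp [hP]⟩

omit [Fintype V] in
theorem getLast?_dedup (l : List V) : l.dedup.getLast? = l.getLast? := by
  induction l with
  | nil => rfl
  | cons a l ih =>
    by_cases h : a ∈ l
    · rw [List.dedup_cons_of_mem h, ih]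
      cases l with
      | nil => simp at h
      | cons b l => simp
    · rw [List.dedup_cons_of_notMem h, List.getLast?_cons, List.getLast?_cons, ih]

omit [Fintype V] in
theorem exists_isShortcut {s t : V} (hst : s ≠ t) (W : (⊤ : SimpleGraph V).Walk s t) :
    ∃ P, IsShortcut W P := by
  obtain ⟨l, hl⟩ : ∃ l, W.support = s :: l := ⟨_, W.cons_tail_support.symm⟩
  have hlast : (s :: l).getLast? = some t := by
    rw [← hl, List.getLast?_eq_getLast_of_ne_nil W.support_ne_nil, W.getLast_support]
  have hl0 : l.getLast? = some t := by
    cases l with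
    | nil => exact absurd (by simpa using hlast) hst
    | cons b l => simpa using hlast
  -- Removing later visits to `s` protects the first vertex; `dedup` keeps last occurrences and so
  -- protects `t`.
  set l' := (l.filter (· ≠ s)).dedup with hl'
  have hmem : ∀ v, v ∈ l' ↔ v ∈ l ∧ v ≠ s := by simp [hl']
  have hlast' : l'.getLast? = some t := by
    obtain ⟨m, rfl⟩ := List.getLast?_eq_some_iff.1 hl0
    rw [hl', getLast?_dedup, List.filter_append]
    simp [hst.symm]
  obtain ⟨P, hP⟩ := exists_walk_support_eq (s := s) (l := l') (t := t)
    (List.nodup_cons.2 ⟨by simp [hmem], List.nodup_dedup _⟩)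
    (by rw [List.getLast?_cons, hlast']; rfl)
  refine ⟨P, ?_, ?_, fun v hv => ?_⟩
  · rw [SimpleGraph.Walk.isPath_def, hP]
    exact List.nodup_cons.2 ⟨by simp [hmem], List.nodup_dedup _⟩
  · rw [hP, hl]
    exact ((List.dedup_sublist _).trans List.filter_sublist).cons_cons s
  · rw [hl] at hv
    rw [hP, List.mem_cons, hmem]
    rcases List.mem_cons.1 hv with h | h
    · exact Or.inl h
    · by_cases hvs : v = s
      · exact Or.inl hvs
      · exact Or.inr ⟨h, hvs⟩

/-- The cost of a list of vertices, where repeating a vertex is free. -/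
def listCost (c : Sym2 V → ℝ) : List V → ℝ
  | [] => 0
  | [_] => 0
  | a :: b :: l => (if a = b then 0 else c s(a, b)) + listCost c (b :: l)

omit [Fintype V] in
theorem walkCost_eq_listCost (c : Sym2 V → ℝ) {s t : V} (P : (⊤ : SimpleGraph V).Walk s t) :
    walkCost c P = listCost c P.support := by
  induction P with
  | nil => simp [walkCost, listCost]
  | @cons u v w h p ih =>
    have huv : u ≠ v := h.ne
    rw [SimpleGraph.Walk.support_cons, ← p.cons_tail_support]
    rw [← p.cons_tail_support] at ih
    rw [listCost, if_neg huv, ← ih]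
    simp [walkCost]

omit [Fintype V] in
-- Deleting one vertex after a kept vertex is a triangle inequality, which also holds for coinciding
-- vertices because repetitions are free.
theorem IsMetricCost.listCost_cons_mono {c : Sym2 V → ℝ} (hc : IsMetricCost c) {l₁ l₂ : List V}
    (h : l₁.Sublist l₂) (a : V) : listCost c (a :: l₁) ≤ listCost c (a :: l₂) := by
  have hnn : ∀ u v : V, 0 ≤ if u = v then 0 else c s(u, v) := by
    intro u v
    split_ifs with h
    · exact le_rfl
    · exact hc.nonneg u v h
  have htri : ∀ u v w : V, (if u = w then 0 else c s(u, w)) ≤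
      (if u = v then 0 else c s(u, v)) + if v = w then 0 else c s(v, w) := by
    intro u v w
    by_cases huw : u = w
    · rw [if_pos huw]
      exact add_nonneg (hnn _ _) (hnn _ _)
    by_cases huv : u = v
    · simp [huv]
    by_cases hvw : v = w
    · simp [hvw]
    simpa [huw, huv, hvw] using hc.triangle u v w huv hvw huw
  induction h generalizing a with
  | slnil => exact le_rfl
  | @cons l₁ l₂ b _ ih =>
    refine (ih a).trans ?_
    cases l₂ with
    | nil => simpa [listCost] using hnn a b
    | cons d l =>
      simp only [listCost]
      linarith [htri a b d]
  | @cons_cons l₁ l₂ b _ ih =>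
    simp only [listCost]
    linarith [ih b]

omit [Fintype V] in
theorem IsShortcut.walkCost_le {c : Sym2 V → ℝ} (hc : IsMetricCost c) {s t : V}
    {W P : (⊤ : SimpleGraph V).Walk s t} (h : IsShortcut W P) : walkCost c P ≤ walkCost c W := by
  rw [walkCost_eq_listCost, walkCost_eq_listCost]
  have h1 := h.2.1
  rw [← P.cons_tail_support, ← W.cons_tail_support] at h1 ⊢
  exact hc.listCost_cons_mono (List.cons_sublist_cons.1 h1) s

/-! ### The randomized Christofides' algorithm -/

theorem wrongDegree_eq (s t : V) (J : Finset (Sym2 V)) :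
    wrongDegree s t J = oddSet J ∆ {s, t} := by
  ext v
  simp only [wrongDegree, mem_filter, mem_univ, true_and, mem_symmDiff, mem_oddSet, mem_insert,
    mem_singleton, ← Nat.not_odd_iff_even]
  tauto

theorem even_card_wrongDegree {s t : V} (hst : s ≠ t) (J : Finset (Sym2 V)) :
    Even #(wrongDegree s t J) := by
  rw [wrongDegree_eq]
  exact even_card_symmDiff (even_card_oddSet J) (by simp [card_pair hst])

theorem IsSpanningTree.cut_inter_nonempty {J : Finset (Sym2 V)} (hJ : IsSpanningTree J)
    {S : Finset V} (hS : S.Nonempty) (hS' : S ≠ univ) : (cut S ∩ J).Nonempty := by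
  obtain ⟨u, hu⟩ := hS
  obtain ⟨v, hv⟩ : ∃ v, v ∉ S := by
    by_contra! h
    exact hS' (eq_univ_iff_forall.2 h)
  obtain ⟨p⟩ := hJ.2.connected.preconnected u v
  obtain ⟨d, -, hd1, hd2⟩ := p.exists_boundary_dart (S : Set V) hu hv
  have hadj := d.adj
  rw [SimpleGraph.fromEdgeSet_adj] at hadj
  exact ⟨s(d.fst, d.snd), mem_inter.2 ⟨mk_mem_cut.2 (Or.inl ⟨hd1, hd2⟩), hadj.1⟩⟩

theorem IsHeldKarpPath.sum_degree_eq {s t : V} {x : Sym2 V → ℝ} (hst : s ≠ t)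
    (hx : IsHeldKarpPath s t x) (S : Finset V) :
    ∑ v ∈ S, ∑ e ∈ cut {v}, x e = 2 * #S - #(S ∩ {s, t}) := by
  have h : ∀ v, ∑ e ∈ cut {v}, x e = 2 - if v ∈ ({s, t} : Finset V) then 1 else 0 := by
    intro v
    by_cases hs : v = s
    · subst hs
      rw [hx.deg_s]
      norm_num
    by_cases ht : v = t
    · subst ht
      rw [hx.deg_t]
      norm_num
    simp [hs, ht, hx.deg v hs ht]
  rw [sum_congr rfl fun v _ => h v, sum_sub_distrib, sum_const, sum_boole, filter_mem_eq_inter,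
    nsmul_eq_mul, mul_comm]

omit [Fintype V] in
theorem card_inter_pair_le_two (S : Finset V) (s t : V) : #(S ∩ {s, t}) ≤ 2 :=
  (card_le_card inter_subset_right).trans card_le_two

/-- Twice the inside sum is the degree sum minus the cut: at most `2#S - 1 - 1` if `S` separates `s`
from `t`, and at most `2#S - 2` otherwise. -/
theorem IsHeldKarpPath.sum_inside_le {s t : V} {x : Sym2 V → ℝ} (hst : s ≠ t)
    (hx : IsHeldKarpPath s t x) {S : Finset V} (hS : S.Nonempty) :
    ∑ e ∈ inside S, x e ≤ #S - 1 := by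
  have h1 := sum_degree x S
  rw [hx.sum_degree_eq hst] at h1
  by_cases hS' : S = univ
  · subst hS'
    rw [univ_inter, card_pair hst, cut_univ, sum_empty] at h1
    push_cast at h1
    linarith
  have h3 := card_inter_pair_le_two S s t
  by_cases h2 : #(S ∩ {s, t}) = 1
  · have := hx.cut_st S hS hS' h2
    rw [h2] at h1
    push_cast at h1
    linarith
  · have := hx.cut_even S hS hS' (by interval_cases #(S ∩ {s, t}) <;> simp_all)
    have h4 : (0 : ℝ) ≤ #(S ∩ {s, t}) := Nat.cast_nonneg _
    linarith

theorem IsHeldKarpPath.sum_edges {s t : V} {x : Sym2 V → ℝ} (hst : s ≠ t)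
    (hx : IsHeldKarpPath s t x) : ∑ e ∈ edges V, x e = Fintype.card V - 1 := by
  have h1 := sum_degree x univ
  rw [hx.sum_degree_eq hst, univ_inter, card_pair hst, cut_univ, sum_empty, inside_univ,
    card_univ] at h1
  push_cast at h1
  linarith

theorem IsHeldKarpPath.nonempty_treeDecomposition {s t : V} {x : Sym2 V → ℝ} (hst : s ≠ t)
    (hx : IsHeldKarpPath s t x) : Nonempty (TreeDecomposition x) := by
  have : Nonempty V := ⟨s⟩
  have key : ∀ D ⊆ edges V, ∑ e ∈ D, (if e ∈ edges V then x e else 0) = ∑ e ∈ D, x e :=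
    fun D hD => sum_congr rfl fun e he => if_pos (hD he)
  -- The diagonal is cleared because the polytope fixes it to 0, while decompositions never read it.
  have hmem : (fun e => if e ∈ edges V then x e else 0) ∈ treePolytope V := by
    refine ⟨fun e he => ?_, fun e he => if_neg he, fun S hS => ?_, ?_⟩
    · simpa only [he, if_true] using hx.nonneg e he
    · rw [key _ (inside_subset_edges S)]
      exact hx.sum_inside_le hst hS
    · rw [key _ subset_rfl]
      exact hx.sum_edges hst
  obtain ⟨D⟩ := STPathTSP.nonempty_treeDecomposition hmem
  exact D.congr fun e he => if_pos he

theorem TreeDecomposition.sum_eq {x : Sym2 V → ℝ} (D : TreeDecomposition x) (c : Sym2 V → ℝ)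
    {A : Finset (Sym2 V)} (hA : A ⊆ edges V) :
    ∑ e ∈ A, c e * x e = ∑ i, D.weight i * ∑ e ∈ A ∩ D.J i, c e := by
  rw [sum_congr rfl fun e he => by rw [← D.decomp e (hA he), mul_sum], sum_comm]
  refine sum_congr rfl fun i _ => ?_
  rw [← sum_ite_mem, mul_sum]
  refine sum_congr rfl fun e _ => ?_
  split_ifs <;> ring

/-- Half-integrality makes the value of each cut separating `s` and `t` an integer. -/
theorem IsHeldKarpPath.exists_int_cut_eq {s t : V} {x : Sym2 V → ℝ} (hst : s ≠ t)
    (hx : IsHeldKarpPath s t x) (hhalf : IsHalfIntegral x) (S : Finset V) :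
    ∃ k : ℤ, ∑ e ∈ cut S, x e = k := by
  choose! k hk using hhalf
  have h1 := sum_degree x S
  rw [hx.sum_degree_eq hst, mul_sum] at h1
  have h2 : ∑ e ∈ inside S, 2 * x e = ((∑ e ∈ inside S, k e : ℤ) : ℝ) := by
    push_cast
    refine sum_congr rfl fun e he => ?_
    rw [hk e (inside_subset_edges S he)]
    ring
  refine ⟨2 * #S - #(S ∩ {s, t}) - ∑ e ∈ inside S, k e, ?_⟩
  push_cast at h2 ⊢
  linarith

theorem IsHeldKarpPath.isFractionalTJoin {s t : V} {x : Sym2 V → ℝ} (hst : s ≠ t)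
    (hx : IsHeldKarpPath s t x) (hhalf : IsHalfIntegral x) (D : TreeDecomposition x)
    (i : Fin D.l) : IsFractionalTJoin (wrongDegree s t (D.J i)) fun e => x e / 2 := by
  refine ⟨fun S hS => ?_, fun e he => div_nonneg (hx.nonneg e he) zero_le_two⟩
  have hSne : S.Nonempty := by
    rw [nonempty_iff_ne_empty]
    rintro rfl
    simp at hS
  have hSu : S ≠ univ := by
    rintro rfl
    rw [univ_inter, ← Nat.not_even_iff_odd] at hS
    exact hS (even_card_wrongDegree hst _)
  suffices h : 2 ≤ ∑ e ∈ cut S, x e by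
    rw [← sum_div]
    linarith
  by_cases hev : Even #(S ∩ {s, t})
  · exact hx.cut_even S hSne hSu hev
  have hle := card_inter_pair_le_two S s t
  have hst1 : #(S ∩ {s, t}) = 1 := by
    rw [Nat.not_even_iff_odd] at hev
    obtain ⟨m, hm⟩ := hev
    omega
  have hge : ∀ j, 1 ≤ #(cut S ∩ D.J j) := fun j =>
    card_pos.2 ((D.spanningTree j).cut_inter_nonempty hSne hSu)
  -- With one terminal in `S`, oddness of `S ∩ T` means that this tree crosses `S` evenly, so not
  -- exactly once.
  have hi : 1 < #(cut S ∩ D.J i) := by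
    have h1 : S ∩ wrongDegree s t (D.J i) = (S ∩ oddSet (D.J i)) ∆ (S ∩ {s, t}) := by
      rw [wrongDegree_eq]
      exact inf_symmDiff_distrib_left _ _ _
    rw [h1, odd_card_symmDiff, ← odd_card_cut_inter, hst1] at hS
    refine lt_of_le_of_ne (hge i) fun h => ?_
    rw [← h] at hS
    exact hS Iff.rfl
  have hsum := D.sum_eq (fun _ => 1) (cut_subset_edges S)
  simp only [one_mul, sum_const, nsmul_eq_mul, mul_one] at hsum
  -- A convex combination of crossing numbers that are all at least 1, one of them larger and with
  -- positive weight.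
  have hlt : 1 < ∑ e ∈ cut S, x e := by
    rw [hsum, ← D.weight_sum]
    refine sum_lt_sum (fun j _ => ?_) ⟨i, mem_univ _, ?_⟩
    · exact le_mul_of_one_le_right (D.weight_pos j).le (by exact_mod_cast hge j)
    · exact lt_mul_of_one_lt_right (D.weight_pos i) (by exact_mod_cast hi)
  obtain ⟨k, hk⟩ := hx.exists_int_cut_eq hst hhalf S
  rw [hk] at hlt ⊢
  have : 1 < k := by exact_mod_cast hlt
  exact_mod_cast this

theorem countP_val {F : Finset (Sym2 V)} (hF : F ⊆ edges V) (v : V) :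
    F.val.countP (v ∈ ·) = #(cut {v} ∩ F) := by
  rw [Multiset.countP_eq_card_filter, ← filter_val, card_val]
  congr 1
  ext e
  rw [mem_filter, mem_inter]
  exact ⟨fun h => ⟨(mem_cut_singleton (hF h.1)).2 h.2, h.1⟩,
    fun h => ⟨h.2, (mem_cut_singleton (hF h.2)).1 h.1⟩⟩

theorem exists_isEulerianTraversal {s t : V} (hst : s ≠ t) {J F : Finset (Sym2 V)}
    (hJ : IsSpanningTree J) (hF : IsTJoin (wrongDegree s t J) F) :
    ∃ W : (⊤ : SimpleGraph V).Walk s t, IsEulerianTraversal J F W := by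
  refine exists_eulerian_walk (fun e he => ?_) (fun v => ?_) fun S hS hS' => ?_
  · rcases Multiset.mem_add.1 he with h | h
    · exact hJ.1 h
    · exact hF.1 h
  · rw [Multiset.countP_add, countP_val hJ.1, countP_val hF.1, Nat.odd_add, ← Nat.not_odd_iff_even,
      hF.2 v, wrongDegree_eq, mem_symmDiff, mem_oddSet, mem_insert, mem_singleton]
    grind
  · obtain ⟨e, he⟩ := hJ.cut_inter_nonempty hS hS'
    exact ⟨e, Multiset.mem_add.2 (Or.inl (mem_inter.1 he).2), (mem_inter.1 he).1⟩

/-- As `s ≠ t`, no vertex is isolated in the tree, and the traversal uses every tree edge. -/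
theorem IsEulerianTraversal.mem_support {s t : V} (hst : s ≠ t) {J F : Finset (Sym2 V)}
    (hJ : IsSpanningTree J) {W : (⊤ : SimpleGraph V).Walk s t} (hW : IsEulerianTraversal J F W)
    (v : V) : v ∈ W.support := by
  have hv : ({v} : Finset V) ≠ univ := by
    intro h
    have h1 : s ∈ ({v} : Finset V) := h ▸ mem_univ s
    have h2 : t ∈ ({v} : Finset V) := h ▸ mem_univ t
    rw [mem_singleton] at h1 h2
    exact hst (h1.trans h2.symm)
  obtain ⟨e, he⟩ := hJ.cut_inter_nonempty (singleton_nonempty v) hv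
  obtain ⟨hev, heJ⟩ := mem_inter.1 he
  rw [mem_cut_singleton (hJ.1 heJ)] at hev
  obtain ⟨u, rfl⟩ := Sym2.mem_iff_exists.1 hev
  have h : s(v, u) ∈ (W.edges : Multiset (Sym2 V)) := by
    rw [hW]
    exact Multiset.mem_add.2 (Or.inl heJ)
  exact W.fst_mem_support_of_mem_edges h

omit [Fintype V] [DecidableEq V] in
theorem IsEulerianTraversal.walkCost_eq {s t : V} {J F : Finset (Sym2 V)}
    {W : (⊤ : SimpleGraph V).Walk s t} (hW : IsEulerianTraversal J F W) (c : Sym2 V → ℝ) :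
    walkCost c W = ∑ e ∈ J, c e + ∑ e ∈ F, c e := by
  have h : walkCost c W = ((W.edges : Multiset (Sym2 V)).map c).sum := by
    rw [Multiset.map_coe, Multiset.sum_coe, walkCost]
  rw [h, hW, Multiset.map_add, Multiset.sum_add]
  rfl

theorem IsMetricCost.nonneg_of_mem {c : Sym2 V → ℝ} (hc : IsMetricCost c) (e : Sym2 V)
    (he : e ∈ edges V) : 0 ≤ c e := by
  induction e with
  | _ a b => exact hc.nonneg a b (mk_mem_edges.1 he)

theorem RandomizedChristofides.isHamiltonian {c : Sym2 V → ℝ} {s t : V} {x : Sym2 V → ℝ}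
    (hst : s ≠ t) (A : RandomizedChristofides c s t x) (i : Fin A.l) :
    (A.output i).IsHamiltonian :=
  (A.shortcut i).1.isHamiltonian_of_mem fun v =>
    (A.shortcut i).2.2 v ((A.eulerian i).mem_support hst (A.spanningTree i) v)

theorem RandomizedChristofides.expectedCost_le {c : Sym2 V → ℝ} {s t : V} {x : Sym2 V → ℝ}
    (hst : s ≠ t) (hc : IsMetricCost c) (hx : IsHeldKarpPath s t x) (hhalf : IsHalfIntegral x)
    (A : RandomizedChristofides c s t x) : A.expectedCost ≤ 3 / 2 * cost c x := by
  have hF : ∀ i, ∑ e ∈ A.F i, c e ≤ cost c x / 2 := by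
    intro i
    rw [(A.minCostTJoin i).sum_eq]
    refine (joinCost_le_of_isFractionalTJoin (even_card_wrongDegree hst _)
      (hx.isFractionalTJoin hst hhalf A.toTreeDecomposition i) c hc.nonneg_of_mem).trans_eq ?_
    simp only [cost, sum_div, mul_div_assoc]
  have hJ : ∑ i, A.weight i * ∑ e ∈ A.J i, c e = cost c x := by
    rw [cost, A.sum_eq c subset_rfl]
    refine sum_congr rfl fun i _ => ?_
    rw [inter_eq_right.2 (A.spanningTree i).1]
  calc A.expectedCost
      ≤ ∑ i, A.weight i * (∑ e ∈ A.J i, c e + cost c x / 2) := by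
        refine sum_le_sum fun i _ => mul_le_mul_of_nonneg_left ?_ (A.weight_pos i).le
        have h1 := (A.shortcut i).walkCost_le hc
        rw [(A.eulerian i).walkCost_eq] at h1
        linarith [hF i]
    _ = 3 / 2 * cost c x := by
        simp only [mul_add, sum_add_distrib]
        rw [hJ, ← sum_mul, A.weight_sum]
        ring

end STPathTSP

/-- Conjuncts one to four: every step of the algorithm can be carried out, whatever choices were
made before. Conjunct five: `x / 2` is a fractional `T`-join for every sampled tree. The last
conjunct: every implementation outputs Hamiltonian paths and obeys the bound. -/
theorem mainTheorem4 {V : Type*} [Fintype V] [DecidableEq V] (s t : V) (hst : s ≠ t)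
    (c : Sym2 V → ℝ) (hc : STPathTSP.IsMetricCost c)
    (x : Sym2 V → ℝ) (hx : STPathTSP.IsHeldKarpPath s t x) (hhalf : STPathTSP.IsHalfIntegral x) :
    Nonempty (STPathTSP.TreeDecomposition x) ∧
    (∀ J : Finset (Sym2 V), STPathTSP.IsSpanningTree J →
      ∃ F, STPathTSP.IsMinCostTJoin c (STPathTSP.wrongDegree s t J) F) ∧
    (∀ J F : Finset (Sym2 V), STPathTSP.IsSpanningTree J →
      STPathTSP.IsMinCostTJoin c (STPathTSP.wrongDegree s t J) F →
        ∃ W : (⊤ : SimpleGraph V).Walk s t, STPathTSP.IsEulerianTraversal J F W) ∧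
    (∀ W : (⊤ : SimpleGraph V).Walk s t, ∃ P, STPathTSP.IsShortcut W P) ∧
    (∀ D : STPathTSP.TreeDecomposition x, ∀ i,
      STPathTSP.IsFractionalTJoin (STPathTSP.wrongDegree s t (D.J i)) (fun e => x e / 2)) ∧
    ∀ A : STPathTSP.RandomizedChristofides c s t x,
      (∀ i, (A.output i).IsHamiltonian) ∧
      A.expectedCost ≤ 3 / 2 * STPathTSP.cost c x := by
  refine ⟨hx.nonempty_treeDecomposition hst, fun J _ => ?_, fun J F hJ hF => ?_,
    STPathTSP.exists_isShortcut hst, hx.isFractionalTJoin hst hhalf, fun A => ?_⟩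
  · exact STPathTSP.exists_isMinCostTJoin c (STPathTSP.even_card_wrongDegree hst J)
  · exact STPathTSP.exists_isEulerianTraversal hst hJ hF.1
  · exact ⟨A.isHamiltonian hst, A.expectedCost_le hst hc hx hhalf⟩
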